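/- Let $\Gamma=(V,E)$ be a countable, locally finite simple graph (not necessarily connected), $\lambda:V\to\mathbb R_{>0}$ an activity function, and $X(\Gamma)\subseteq\{0,1\}^V$ the set of (indicators of) independent sets of $\Gamma$, with its Borel $\sigma$-algebra. For finite $U\subseteq V$ and $y\in X(\Gamma)$ let $\pi^y_U$ be the probability on $\{z\in X(\Gamma): z=y \text{ off } U\}$ with $\pi^y_U(z)\propto\prod_{u\in U}\lambda(u)^{z(u)}$. A Borel probability measure $\mathbb P$ on $X(\Gamma)$ is a Gibbs measure for $(\Gamma,\lambda)$ if for all finite $U'\subseteq U\subseteq V$ and $x\in X(\Gamma)$ one has $\mathbb P([x_{U'}]\mid\mathcal B_{U^c})(y)=\pi_U^y([x_{U'}])$ for $\mathbb P$-a.e. $y$, where $[x_W]$ is the event of agreeing with $x$ on $W$ and $\mathcal B_{U^c}$ is generated by the coordinates off $U$. The model $(\Gamma,\lambda)$ exhibits strong spatial mixing (SSM) if there is $\delta:\mathbb N\to\mathbb R_{\ge0}$ with $\delta(n)\to0$ such that $|\pi^y_U([0^u])-\pi^z_U([0^u])|\le\delta(\mathrm{dist}(u,\{u'\notin U:y(u')\ne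 z(u')\}))$ for all finite $U\subseteq V$, $u\in U$, $y,z\in X(\Gamma)$ (with $\delta(\infty)=0$), where $[0^u]$ is the event that $u$ is unoccupied. For $v\in V$, $T=T_{\mathrm{SAW}}(\Gamma,v)$ is the tree whose vertices are the trails $w=(v_1,\dots,v_n)$, $n\ge 1$, $v_1=v$ (consecutive vertices adjacent, no undirected edge repeated) that either repeat no vertex, or are such that $v_1,\dots,v_{n-1}$ are distinct and $v_n\in\{v_1,\dots,v_{n-1}\}$ (call the latter closing); two trails are adjacent if one is a one-vertex extension of the other. Its root is $\rho=(v)$, and $\overline\lambda(w)=\lambda(u)$ if $w$ ends in $u$. For each $u\in V$ fix an arbitrary ordering of the neighbours of $u$; a closing trail $w=(v,\dots,u,a,\dots,b,u)$ is tagged $1$ (occupied) if $a$ precedes $b$ in the ordering at $u$, and $0$ (unoccupied) otherwise. For $x\in X(\Gamma)$ and $U\subseteq V$, let $\overline{x_U}$ be the partial configuration on $T$ that takes the value $x(u)$ at every trail ending in a vertex $u\in U$, takes the value of the tag at every closing trail that visits no vertex of $U$, and is unspecified elsewhere. For a measure $\mathbb P$, an event $A$ and a partial configuration $\xi$ on a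 possibly infinite set $C$ of vertices, $\mathbb P(A\mid[\xi])$ denotes the limit of the elementary conditional probabilities $\mathbb P(A\mid[\xi_F])$ along the finite subsets $F$ of $C$ directed by inclusion, all the events $[\xi_F]$ having positive probability (for finite $C$ this is $\mathbb P(A\mid[\xi])$ in the elementary sense). **Theorem.** Let $v\in V$ be such that $(T_{\mathrm{SAW}}(\Gamma,v),\overline\lambda)$ exhibits SSM. Then $(\Gamma,\lambda)$ has a Gibbs measure, $(T_{\mathrm{SAW}}(\Gamma,v),\overline\lambda)$ has exactly one Gibbs measure $\mathbb P_{T,\overline\lambda}$, and for every Gibbs measure $\mathbb P_{\Gamma,\lambda}$ of $(\Gamma,\lambda)$, every $x\in X(\Gamma)$ and every (possibly infinite) $U\subseteq V$, both of the following conditional probabilities exist and $$\mathbb P_{\Gamma,\lambda}([0^v]\mid[x_U])=\mathbb P_{T,\overline\lambda}([0^\rho]\mid[\overline{x_U}]).$$ -/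

import Mathlib

open MeasureTheory Filter Topology

noncomputable section

namespace Hardcore

variable {V : Type*}

/-! ### The hardcore model -/

/-- The space `X(G)` of independent sets of `G`, as `0/1`-configurations
(`true` is occupied, `false` is unoccupied). Its sigma-algebra is the one inherited from the
product `V → Bool`. -/
def indepSets (G : SimpleGraph V) : Set (V → Bool) :=
  {x | ∀ u w, G.Adj u w → x u = true → x w = false}

/-- The event `[x_W]`: configurations that agree with `x` on `W`. -/
def cylinder (G : SimpleGraph V) (x : V → Bool) (W : Set V) : Set (indepSets G) :=
  {z | ∀ u ∈ W, z.1 u = x u}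

/-- The event `[0^v]` that `v` is unoccupied. -/
def unoccupied (G : SimpleGraph V) (v : V) : Set (indepSets G) :=
  {z | z.1 v = false}

/-- The weight `∏_{v ∈ U} lam(v)^{x(v)}`. -/
def weight (lam : V → ℝ) (U : Finset V) (x : V → Bool) : ℝ :=
  ∏ u ∈ U, if x u = true then lam u else 1

open Classical in
/-- The configuration that is the indicator of `S` on `U` and equals `y` off `U`. -/
def patch (U S : Finset V) (y : V → Bool) : V → Bool :=
  fun u => if u ∈ U then decide (u ∈ S) else y u

open Classical in
/-- The unnormalised mass of the event `A` in the finite volume `U` with boundary condition `y`: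
the sum of the weights of the independent sets that equal `y` off `U` and belong to `A`. -/
def volumeMass (G : SimpleGraph V) (lam : V → ℝ) (U : Finset V) (y : V → Bool)
    (A : Set (V → Bool)) : ℝ :=
  ∑ S ∈ U.powerset with patch U S y ∈ indepSets G ∩ A, weight lam U (patch U S y)

/-- The Gibbs specification `π_U^y(A)`. -/
def specification (G : SimpleGraph V) (lam : V → ℝ) (U : Finset V) (y : V → Bool)
    (A : Set (V → Bool)) : ℝ :=
  volumeMass G lam U y A / volumeMass G lam U y Set.univ

/-- The sigma-algebra on `X(G)` generated by the coordinates outside `U`. -/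
abbrev outsideSigma (G : SimpleGraph V) (U : Finset V) : MeasurableSpace (indepSets G) :=
  MeasurableSpace.comap (fun (z : indepSets G) (u : {u : V // u ∉ U}) => z.1 u.1)
    MeasurableSpace.pi

/-- Gibbs measures for `(G, lam)`: Borel probability measures on `X(G)` whose conditional
probabilities given the configuration off any finite `U` are given by the specification. -/
structure IsGibbs (G : SimpleGraph V) (lam : V → ℝ) (P : Measure (indepSets G)) : Prop where
  isProbabilityMeasure : IsProbabilityMeasure P
  condExp_eq : ∀ (U U' : Finset V), U' ⊆ U → ∀ x ∈ indepSets G,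
    P[(cylinder G x U').indicator (fun _ => (1 : ℝ)) | outsideSigma G U] =ᵐ[P]
      fun y => specification G lam U y.1 {z | ∀ u ∈ U', z u = x u}

/-- The graph distance (possibly infinite) from a vertex to a set of vertices. -/
def distToSet (G : SimpleGraph V) (v : V) (D : Set V) : ℕ∞ :=
  ⨅ w ∈ D, G.edist v w

/-- The vertices outside `U` at which `y` and `z` differ. -/
def disagreement (U : Finset V) (y z : V → Bool) : Set V :=
  {w | w ∉ U ∧ y w ≠ z w}

/-- Strong spatial mixing. The bound is required whenever the distance is a finite number `n`; at
distance `∞` the two probabilities are automatically equal. -/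
def StrongSpatialMixing (G : SimpleGraph V) (lam : V → ℝ) : Prop :=
  ∃ δ : ℕ → ℝ, (∀ n, 0 ≤ δ n) ∧ Tendsto δ atTop (𝓝 0) ∧
    ∀ (U : Finset V), ∀ v ∈ U, ∀ y ∈ indepSets G, ∀ z ∈ indepSets G, ∀ n : ℕ,
      distToSet G v (disagreement U y z) = n →
        |specification G lam U y {s | s v = false} -
          specification G lam U z {s | s v = false}| ≤ δ n

/-- `p` is the conditional probability of the event `A` given that the configuration equals `x`
on the (possibly infinite) set `C`: every finite part of the condition has positive probability,
and the elementary conditional probabilities given `[x_F]`, for `F` finite contained in `C`,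
converge to `p` as `F` increases to `C`. (For finite `C` this is elementary conditioning.) -/
def HasCondProb (G : SimpleGraph V) (P : Measure (indepSets G)) (A : Set (indepSets G))
    (x : V → Bool) (C : Set V) (p : ℝ) : Prop :=
  (∀ F : Finset V, (F : Set V) ⊆ C → 0 < P (cylinder G x F)) ∧
    Tendsto (fun F : Finset C =>
      (ProbabilityTheory.cond P (cylinder G x (Subtype.val '' (F : Set C)))).real A)
      atTop (𝓝 p)

/-! ### The tree of self-avoiding walks -/

/-- Trails starting from `v`: finite sequences of vertices whose consecutive members are adjacent
and whose (undirected) edges are not repeated. -/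
structure IsTrailFrom (G : SimpleGraph V) (v : V) (w : List V) : Prop where
  head_eq : w.head? = some v
  chain : w.IsChain G.Adj
  edges_nodup : (List.zipWith (fun a b => s(a, b)) w w.tail).Nodup

/-- `W_0`: trails from `v` that repeat no vertex. -/
def simpleTrails (G : SimpleGraph V) (v : V) : Set (List V) :=
  {w | IsTrailFrom G v w ∧ w.Nodup}

/-- `W_1`: trails from `v` that repeat a single vertex once and then stop. -/
def closingTrails (G : SimpleGraph V) (v : V) : Set (List V) :=
  {w | IsTrailFrom G v w ∧ ¬ w.Nodup ∧ w.dropLast.Nodup}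

/-- The vertex set `W_0 ∪ W_1` of the tree of self-avoiding walks from `v`. -/
abbrev SAWVertex (G : SimpleGraph V) (v : V) : Type _ :=
  {w : List V // w ∈ simpleTrails G v ∪ closingTrails G v}

/-- The tree of self-avoiding walks from `v`: trails are adjacent when one of them is a one-vertex
extension of the other. -/
def sawTree (G : SimpleGraph V) (v : V) : SimpleGraph (SAWVertex G v) where
  Adj w w' := (∃ a, w'.1 = w.1 ++ [a]) ∨ (∃ a, w.1 = w'.1 ++ [a])
  symm := ⟨fun _ _ h => h.symm⟩
  loopless := ⟨fun w h => by
    rcases h with ⟨a, h⟩ | ⟨a, h⟩ <;> simpa using congrArg List.length h⟩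

/-- The root `(v)`. -/
def sawRoot (G : SimpleGraph V) (v : V) : SAWVertex G v :=
  ⟨[v], Or.inl ⟨⟨rfl, by simp, by simp⟩, by simp⟩⟩

theorem SAWVertex.ne_nil {G : SimpleGraph V} {v : V} (w : SAWVertex G v) : w.1 ≠ [] := by
  intro h
  rcases w.2 with h' | h' <;> simpa [h] using h'.1.head_eq

/-- The last vertex of a trail. -/
def sawEnd {G : SimpleGraph V} {v : V} (w : SAWVertex G v) : V :=
  w.1.getLast w.ne_nil

/-- The activity function on the tree: the activity of the last vertex of the trail. -/
def sawActivity (G : SimpleGraph V) (lam : V → ℝ) (v : V) : SAWVertex G v → ℝ :=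
  fun w => lam (sawEnd w)

/-- A trail `(v, …, u, a, …, b, u)` in `W_1` is tagged occupied when `a` precedes `b` in the
chosen ordering of the neighbours of `u`, and unoccupied otherwise. The ordering at `u` is given
by the numbering `idx u` of the neighbours of `u`. -/
def taggedOccupied (idx : V → V → ℕ) (w : List V) : Prop :=
  ∃ (p : List V) (u a : V) (q : List V) (b : V),
    w = p ++ [u, a] ++ q ++ [b, u] ∧ idx u a < idx u b

/-- The set of trails at which the tree is conditioned: the set `W(U)` of all trails that end in
`U`, together with the tagged trails (those in `W_1`) that do not lie below `W(U)`, that is, do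
not visit `U`. -/
def sawCondSet (G : SimpleGraph V) (v : V) (U : Set V) : Set (SAWVertex G v) :=
  {w | sawEnd w ∈ U} ∪ {w | w.1 ∈ closingTrails G v ∧ ∀ u ∈ w.1, u ∉ U}

open Classical in
/-- The values imposed on `sawCondSet G v U`: on a trail ending in `u ∈ U` the value `x u`, and on
the other trails the tag. -/
def sawCondValue (G : SimpleGraph V) (idx : V → V → ℕ) (v : V) (x : V → Bool) (U : Set V) :
    SAWVertex G v → Bool :=
  fun w => if sawEnd w ∈ U then x (sawEnd w) else decide (taggedOccupied idx w.1)

end Hardcore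

end

/-! The engine is Weitz's recursion. In a finite hardcore model on `S`, the probability that `v` is
unoccupied is `1 / (1 + lam v * ∏ ...)`, the product running over the neighbours `a` of `v`. Its
factors are the probabilities that `a` is unoccupied once `v` and the neighbours after `a` are
deleted (`unoccProb_eq`). Unfolding this follows self-avoiding walks, and the same recursion holds
on the tree of walks. A walk that left `c` towards `a` may not end at a later neighbour `b` of `c`;
on the tree an occupied tag on the closing child of `b` enforces exactly this. An unoccupied tag has
no effect. Hence the finite-volume identity `specification_eq_specification_sawTree`, which uses no
mixing.

Passing to infinite volume uses mixing on the tree only. Strong spatial mixing there says that a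
finite set `B` of trails determines the law at the root up to `ε` (`HasDecay`). With `B` fixed,
condition on a finite part of `U` that contains every vertex of `U` visited by `B`. In a suitable
finite volume of `G`, every compatible boundary condition then induces on `B` the same tree boundary
values as `U` does. The identity and the consistency of the finite-volume laws place the conditional
probability on `G` within `ε` of a number `q`. The conditional probabilities on the tree are within
`ε` of the same `q` directly (`exists_forall_eventually_abs_cond_sub_le`), so both nets converge to
one limit.

Gibbs measures exist by compactness (`exists_isGibbs`), and decay makes the one on the tree unique
(`HasDecay.eq_of_isGibbs`). -/

noncomputable section

namespace Hardcore

variable {V : Type*}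

/-! ### Independence polynomials of finite vertex sets -/

open Classical in
/-- The sum of `∏_{u ∈ I} lam u` over the independent sets `I ⊆ S`. -/
def indepSum (G : SimpleGraph V) (lam : V → ℝ) (S : Finset V) : ℝ :=
  ∑ I ∈ S.powerset with ∀ u ∈ I, ∀ w ∈ I, ¬ G.Adj u w, ∏ u ∈ I, lam u

theorem indepSum_pos (G : SimpleGraph V) {lam : V → ℝ} (hlam : ∀ u, 0 < lam u) (S : Finset V) :
    0 < indepSum G lam S := by
  classical
  refine Finset.sum_pos (fun I _ => Finset.prod_pos fun u _ => hlam u) ⟨∅, ?_⟩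
  simp

-- Independent sets containing `v` are `insert v I` with `I` avoiding `v` and its neighbours.
open Classical in
theorem indepSum_eq_add (G : SimpleGraph V) (lam : V → ℝ) {S : Finset V} {v : V} (hv : v ∈ S) :
    indepSum G lam S = indepSum G lam (S.erase v) +
      lam v * indepSum G lam ((S.erase v).filter fun w => ¬ G.Adj v w) := by
  unfold indepSum
  rw [← Finset.sum_filter_add_sum_filter_not _ (fun I => v ∉ I), Finset.mul_sum]
  congr 1
  · refine Finset.sum_congr ?_ fun _ _ => rfl
    ext I
    simp only [Finset.mem_filter, Finset.mem_powerset, Finset.subset_erase]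
    tauto
  · symm
    refine Finset.sum_bij (fun I _ => insert v I) ?_ ?_ ?_ ?_
    · intro I hI
      simp only [Finset.mem_filter, Finset.mem_powerset] at hI ⊢
      have hI' : ∀ w ∈ I, w ≠ v ∧ w ∈ S ∧ ¬ G.Adj v w := fun w hw => by
        simpa [and_assoc] using hI.1 hw
      refine ⟨⟨?_, ?_⟩, by simp⟩
      · intro w hw
        rcases Finset.mem_insert.1 hw with rfl | hw
        exacts [hv, (hI' w hw).2.1]
      · intro u hu w hw
        rcases Finset.mem_insert.1 hu with hu | hu <;> rcases Finset.mem_insert.1 hw with hw | hw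
        · rw [hu, hw]
          exact G.irrefl
        · rw [hu]
          exact (hI' w hw).2.2
        · rw [hw]
          exact fun h => (hI' u hu).2.2 h.symm
        · exact hI.2 u hu w hw
    · intro I hI J hJ h
      simp only [Finset.mem_filter, Finset.mem_powerset] at hI hJ
      have hvI : v ∉ I := fun h => by simpa using hI.1 h
      have hvJ : v ∉ J := fun h => by simpa using hJ.1 h
      rw [← Finset.erase_insert hvI, h, Finset.erase_insert hvJ]
    · intro J hJ
      simp only [Finset.mem_filter, Finset.mem_powerset, not_not] at hJ
      refine ⟨J.erase v, ?_, Finset.insert_erase hJ.2⟩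
      simp only [Finset.mem_filter, Finset.mem_powerset]
      refine ⟨fun w hw => ?_, fun u hu w hw => hJ.1.2 u (Finset.mem_of_mem_erase hu) w
        (Finset.mem_of_mem_erase hw)⟩
      rw [Finset.mem_erase] at hw
      simp only [Finset.mem_filter, Finset.mem_erase]
      exact ⟨⟨hw.1, hJ.1.1 hw.2⟩, hJ.1.2 v hJ.2 w hw.2⟩
    · intro I hI
      simp only [Finset.mem_filter, Finset.mem_powerset] at hI
      have hvI : v ∉ I := fun h => by simpa using hI.1 h
      rw [Finset.prod_insert hvI]

open Classical in
/-- The probability that `v` is unoccupied in the hardcore model on the finite vertex set `S`. -/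
def unoccProb (G : SimpleGraph V) (lam : V → ℝ) (v : V) (S : Finset V) : ℝ :=
  indepSum G lam (S.erase v) / indepSum G lam S

-- A telescoping product: the vertices of `A` are deleted in decreasing order of `f`, so that when
-- `a` goes, exactly the members of `A` with larger value are already gone. Inserting a new minimum
-- in the induction appends one last deletion.
open Classical in
theorem indepSum_sdiff_div (G : SimpleGraph V) {lam : V → ℝ} (hlam : ∀ u, 0 < lam u)
    (f : V → ℕ) (S A : Finset V) (hf : Set.InjOn f A) :
    indepSum G lam (S \ A) / indepSum G lam S =
      ∏ a ∈ A, unoccProb G lam a (S.filter fun b => ¬ (b ∈ A ∧ f a < f b)) := by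
  induction A using Finset.induction_on_min_value f with
  | empty => simp [(indepSum_pos G hlam S).ne']
  | insert a A ha hmin ih =>
    have hlt : ∀ b ∈ A, f a < f b := fun b hb => lt_of_le_of_ne (hmin b hb) fun h =>
      ha (by rwa [hf (by simp) (by simp [hb]) h])
    rw [Finset.prod_insert ha]
    have h1 : (S.filter fun b => ¬ (b ∈ insert a A ∧ f a < f b)) = S \ A := by
      ext b
      simp only [Finset.mem_filter, Finset.mem_sdiff, Finset.mem_insert]
      refine and_congr_right fun _ => not_congr ⟨?_, fun h => ⟨Or.inr h, hlt b h⟩⟩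
      rintro ⟨rfl | h, h'⟩
      exacts [(lt_irrefl _ h').elim, h]
    have h2 : ∀ c ∈ A, (S.filter fun b => ¬ (b ∈ insert a A ∧ f c < f b)) =
        S.filter fun b => ¬ (b ∈ A ∧ f c < f b) := fun c hc => by
      refine Finset.filter_congr fun b _ => not_congr ⟨?_, fun h => ⟨by simp [h.1], h.2⟩⟩
      rintro ⟨h, h'⟩
      rcases Finset.mem_insert.1 h with rfl | h
      exacts [(lt_asymm h' (hlt c hc)).elim, ⟨h, h'⟩]
    rw [h1, Finset.prod_congr rfl fun c hc => by rw [h2 c hc],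
      ← ih (hf.mono (by simp)), unoccProb]
    have h3 : S \ insert a A = (S \ A).erase a := by
      ext; simp; tauto
    rw [h3, div_mul_div_cancel₀ (indepSum_pos G hlam _).ne']

-- Dividing `indepSum_eq_add` by the sum over `S.erase v` leaves the ratio in which all neighbours
-- of `v` are deleted; `indepSum_sdiff_div` factors it.
open Classical in
theorem unoccProb_eq (G : SimpleGraph V) {lam : V → ℝ} (hlam : ∀ u, 0 < lam u) (f : V → ℕ)
    {S : Finset V} {v : V} (hv : v ∈ S) (hf : Set.InjOn f {a | a ∈ S ∧ G.Adj v a}) :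
    unoccProb G lam v S = 1 / (1 + lam v * ∏ a ∈ (S.erase v).filter (G.Adj v),
      unoccProb G lam a ((S.erase v).filter fun b => ¬ (G.Adj v b ∧ f a < f b))) := by
  have h := indepSum_sdiff_div G hlam f (S.erase v) ((S.erase v).filter (G.Adj v))
    (hf.mono fun a ha => by simp at ha; exact ⟨ha.1.2, ha.2⟩)
  have h0 := indepSum_pos G hlam (S.erase v)
  rw [Finset.prod_congr rfl (g := fun a => unoccProb G lam a
    ((S.erase v).filter fun b => ¬ (G.Adj v b ∧ f a < f b)))] at h
  · rw [← h, unoccProb, indepSum_eq_add G lam hv, ← Finset.filter_not]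
    field_simp
  · intro a _
    congr 1
    refine Finset.filter_congr fun b hb => ?_
    simp [Finset.mem_erase.1 hb]

/-! ### The recursion on the tree of self-avoiding walks -/

open Classical in
/-- The walk `u :: l` can be followed in `S` when every step from `c` to `a` removes from the
available vertices `c` and the neighbours of `c` that come after `a` in the ordering at `c`. -/
def Survives (G : SimpleGraph V) (idx : V → V → ℕ) : V → Finset V → List V → Prop
  | u, S, [] => u ∈ S
  | u, S, a :: l => u ∈ S ∧
      Survives G idx a ((S.erase u).filter fun b => ¬ (G.Adj u b ∧ idx u a < idx u b)) l

/-- The list `w` repeats no vertex, stays in `S`, and after a step from `c` to `a` never visits a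
neighbour of `c` that comes after `a` in the ordering at `c`. -/
def IsOrderedPath (G : SimpleGraph V) (idx : V → V → ℕ) (S : Finset V) (w : List V) : Prop :=
  w.Nodup ∧ (∀ c ∈ w, c ∈ S) ∧
    ∀ p c a q b r, w = p ++ c :: a :: (q ++ b :: r) → G.Adj c b → ¬ idx c a < idx c b

/-- Unfolds the successive deletions into a condition on the whole walk, the form that can be
compared with tags on closing trails. -/
theorem survives_iff (G : SimpleGraph V) (idx : V → V → ℕ) (u : V) (S : Finset V) (l : List V) :
    Survives G idx u S l ↔ IsOrderedPath G idx S (u :: l) := by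
  classical
  unfold IsOrderedPath
  induction l generalizing u S with
  | nil =>
    simp only [Survives, List.nodup_cons, List.mem_singleton]
    refine ⟨fun h => ⟨by simp, by simpa using h, ?_⟩, fun h => h.2.1 u rfl⟩
    intro p c a q b r h
    have := congrArg List.length h
    simp at this
    omega
  | cons a l ih =>
    simp only [Survives]
    rw [ih]
    constructor
    · rintro ⟨hu, hn, hS, hd⟩
      have hS' : ∀ c ∈ a :: l, (c ≠ u ∧ c ∈ S) ∧ ¬ (G.Adj u c ∧ idx u a < idx u c) :=
        fun c hc => by simpa only [Finset.mem_filter, Finset.mem_erase] using hS c hc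
      refine ⟨List.nodup_cons.2 ⟨fun h => (hS' u h).1.1 rfl, hn⟩, ?_, ?_⟩
      · intro c hc
        rcases List.mem_cons.1 hc with rfl | hc
        exacts [hu, (hS' c hc).1.2]
      · intro p c a' q b r h hadj
        cases p with
        | nil =>
          simp only [List.nil_append, List.cons.injEq] at h
          obtain ⟨rfl, rfl, rfl⟩ := h
          exact fun hlt => (hS' b (by simp)).2 ⟨hadj, hlt⟩
        | cons d p =>
          simp only [List.cons_append, List.cons.injEq] at h
          exact hd p c a' q b r h.2 hadj
    · rintro ⟨hn, hS, hd⟩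
      refine ⟨hS u (by simp), (List.nodup_cons.1 hn).2, ?_, ?_⟩
      · intro c hc
        simp only [Finset.mem_filter, Finset.mem_erase]
        refine ⟨⟨fun h => (List.nodup_cons.1 hn).1 (h ▸ hc), hS c (by simp [hc])⟩, ?_⟩
        rintro ⟨hadj, hlt⟩
        rcases List.mem_cons.1 hc with rfl | hc
        · exact lt_irrefl _ hlt
        · obtain ⟨q, r, rfl⟩ := List.append_of_mem hc
          exact hd [] u a q c r rfl hadj hlt
      · intro p c a' q b r h
        exact hd (u :: p) c a' q b r (by rw [h]; rfl)

/-! ### Edges of trails, and one-vertex extensions -/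

theorem mem_of_mem_edges {w : List V} {e : Sym2 V}
    (he : e ∈ List.zipWith (fun a b => s(a, b)) w w.tail) {c : V} (hc : c ∈ e) : c ∈ w := by
  induction w with
  | nil => simp at he
  | cons a w ih =>
    cases w with
    | nil => simp at he
    | cons b w =>
      simp only [List.tail_cons, List.zipWith_cons_cons, List.mem_cons] at he ih ⊢
      rcases he with rfl | he
      · simp at hc; tauto
      · exact Or.inr (ih he)

theorem edges_nodup_of_nodup {w : List V} (hw : w.Nodup) :
    (List.zipWith (fun a b => s(a, b)) w w.tail).Nodup := by
  induction w with
  | nil => simp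
  | cons a w ih =>
    cases w with
    | nil => simp
    | cons b w =>
      simp only [List.tail_cons, List.zipWith_cons_cons, List.nodup_cons] at ih ⊢
      refine ⟨fun h => (List.nodup_cons.1 hw).1 (mem_of_mem_edges (w := b :: w) h (c := a)
        (by simp)), ih (by simpa using (List.nodup_cons.1 hw).2)⟩

theorem edges_append_pair (l : List V) (b a : V) :
    List.zipWith (fun a b => s(a, b)) (l ++ [b, a]) (l ++ [b, a]).tail =
      List.zipWith (fun a b => s(a, b)) (l ++ [b]) (l ++ [b]).tail ++ [s(b, a)] := by
  induction l with
  | nil => simp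
  | cons c l ih => cases l <;> simp_all

theorem mem_simpleTrails {G : SimpleGraph V} {v : V} {w : List V} :
    w ∈ simpleTrails G v ↔ w.head? = some v ∧ w.IsChain G.Adj ∧ w.Nodup :=
  ⟨fun h => ⟨h.1.head_eq, h.1.chain, h.2⟩,
    fun h => ⟨⟨h.1, h.2.1, edges_nodup_of_nodup h.2.2⟩, h.2.2⟩⟩

theorem append_singleton_mem_simpleTrails {G : SimpleGraph V} {v : V} {w : SAWVertex G v} {a : V}
    (hw : w.1.Nodup) (hadj : G.Adj (sawEnd w) a) (ha : a ∉ w.1) :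
    w.1 ++ [a] ∈ simpleTrails G v := by
  have hT : IsTrailFrom G v w.1 := by
    rcases w.2 with h | h <;> exact h.1
  rw [mem_simpleTrails]
  refine ⟨?_, ?_, ?_⟩
  · rw [List.head?_append_of_ne_nil _ w.ne_nil, hT.head_eq]
  · rw [List.isChain_append]
    refine ⟨hT.chain, by simp, ?_⟩
    intro x hx y hy
    rw [List.getLast?_eq_some_getLast w.ne_nil] at hx
    simp at hx hy
    subst hx hy
    exact hadj
  · rw [List.nodup_append]
    exact ⟨hw, by simp, by rintro b hb c hc rfl; simp at hc; exact ha (hc ▸ hb)⟩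

theorem sawEnd_of_eq_append {G : SimpleGraph V} {v : V} {w : SAWVertex G v} {l : List V} {a : V}
    (h : w.1 = l ++ [a]) : sawEnd w = a := by
  simp [sawEnd, h]

theorem adj_sawEnd_of_eq_append {G : SimpleGraph V} {v : V} {w w' : SAWVertex G v} {a : V}
    (h : w'.1 = w.1 ++ [a]) : G.Adj (sawEnd w) a := by
  have hT : IsTrailFrom G v w'.1 := by
    rcases w'.2 with h | h <;> exact h.1
  have h1 := hT.chain
  rw [h, List.isChain_append] at h1
  exact h1.2.2 _ (by rw [List.getLast?_eq_some_getLast w.ne_nil]; simp [sawEnd]) a (by simp)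

open Classical in
/-- The occupation probabilities of the graph and of its tree of self-avoiding walks agree when the
finite set `R` of trails corresponds to `S` below the trail `w`. -/
theorem unoccProb_eq_unoccProb_sawTree (G : SimpleGraph V) {lam : V → ℝ} (hlam : ∀ u, 0 < lam u)
    {idx : V → V → ℕ} (hidx : ∀ u, Set.InjOn (idx u) (G.neighborSet u)) (v : V) (S : Finset V)
    (w : SAWVertex G v) (R : Finset (SAWVertex G v)) (hw : w.1.Nodup) (hS : sawEnd w ∈ S)
    (hR : w ∈ R) (hparent : ∀ w' ∈ R, ∀ a, w.1 ≠ w'.1 ++ [a])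
    (hdrop : ∀ c ∈ w.1, c ≠ sawEnd w → c ∉ S)
    (hiff : ∀ l a, Survives G idx (sawEnd w) S l → ∀ w' : SAWVertex G v,
      w'.1 = w.1 ++ l ++ [a] → (w' ∈ R ↔ Survives G idx (sawEnd w) S (l ++ [a]))) :
    unoccProb G lam (sawEnd w) S = unoccProb (sawTree G v) (sawActivity G lam v) w R := by
  -- Induction on the size of `S`, which loses `sawEnd w` at each step. The starting trail `w` is
  -- arbitrary so that the induction can move to a child. Since `hiff` assumes that `l` survives,
  -- `R` may contain anything below a blocked trail: such trails are cut off from `w` in `R`.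
  obtain ⟨n, hn⟩ : ∃ n, S.card ≤ n := ⟨_, le_rfl⟩
  induction n generalizing S w R with
  | zero => simp [Finset.card_eq_zero.1 (Nat.le_zero.1 hn)] at hS
  | succ n ih =>
  have hadjR : ∀ w' ∈ R, (sawTree G v).Adj w w' → ∃ a, w'.1 = w.1 ++ [a] := by
    rintro w' hw' (h | ⟨a, h⟩)
    exacts [h, (hparent w' hw' a h).elim]
  rw [unoccProb_eq G hlam (idx (sawEnd w)) hS ((hidx (sawEnd w)).mono fun a ha => ha.2),
    unoccProb_eq (sawTree G v) (lam := sawActivity G lam v) (fun _ => hlam _)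
      (fun w' => idx (sawEnd w) (sawEnd w')) hR]
  swap
  · rintro w₁ ⟨h₁, hadj₁⟩ w₂ ⟨h₂, hadj₂⟩ h
    obtain ⟨a₁, e₁⟩ := hadjR _ h₁ hadj₁
    obtain ⟨a₂, e₂⟩ := hadjR _ h₂ hadj₂
    simp only [sawEnd_of_eq_append e₁, sawEnd_of_eq_append e₂] at h
    have := hidx _ (adj_sawEnd_of_eq_append e₁) (adj_sawEnd_of_eq_append e₂) h
    exact Subtype.ext (by rw [e₁, e₂, this])
  congr 3
  symm
  -- The children of `w` in `R` correspond to the neighbours of `sawEnd w` in `S`, since `hdrop`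
  -- makes every such one-vertex extension a simple trail.
  refine Finset.prod_bij (fun w' _ => sawEnd w') ?_ ?_ ?_ ?_
  · intro w' hw'
    simp only [Finset.mem_filter, Finset.mem_erase] at hw' ⊢
    obtain ⟨a, ha⟩ := hadjR _ hw'.1.2 hw'.2
    have h := (hiff [] a hS w' (by simpa using ha)).1 hw'.1.2
    have h2 := h.2
    simp only [Survives, Finset.mem_filter, Finset.mem_erase] at h2
    rw [sawEnd_of_eq_append ha]
    exact ⟨h2.1, adj_sawEnd_of_eq_append ha⟩
  · intro w₁ h₁ w₂ h₂ h
    simp only [Finset.mem_filter, Finset.mem_erase] at h₁ h₂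
    obtain ⟨a₁, e₁⟩ := hadjR _ h₁.1.2 h₁.2
    obtain ⟨a₂, e₂⟩ := hadjR _ h₂.1.2 h₂.2
    simp only [sawEnd_of_eq_append e₁, sawEnd_of_eq_append e₂] at h
    exact Subtype.ext (by rw [e₁, e₂, h])
  · intro a ha
    simp only [Finset.mem_filter, Finset.mem_erase] at ha
    have haw : a ∉ w.1 := fun h => hdrop a h ha.1.1 ha.1.2
    have hmem := append_singleton_mem_simpleTrails hw ha.2 haw
    refine ⟨⟨_, Or.inl hmem⟩, ?_, sawEnd_of_eq_append rfl⟩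
    simp only [Finset.mem_filter, Finset.mem_erase]
    refine ⟨⟨fun h => by simpa using congrArg (fun t => t.1.length) h, ?_⟩, Or.inl ⟨a, rfl⟩⟩
    refine (hiff [] a hS _ (by simp)).2 ⟨hS, ?_⟩
    simp [Survives, ha.1.1, ha.1.2]
  · intro w' hw'
    simp only [Finset.mem_filter, Finset.mem_erase] at hw'
    obtain ⟨a, ha⟩ := hadjR _ hw'.1.2 hw'.2
    have hsurv := (hiff [] a hS w' (by simpa using ha)).1 hw'.1.2
    have hend := sawEnd_of_eq_append ha
    have haS := hsurv.2
    simp only [Survives] at haS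
    have haS' := haS
    simp only [Finset.mem_filter, Finset.mem_erase] at haS'
    have haw : a ∉ w.1 := fun h => hdrop a h haS'.1.1 haS'.1.2
    have hw'n : w'.1.Nodup := by
      rw [ha, List.nodup_append]
      exact ⟨hw, by simp, by rintro b hb c hc rfl; simp at hc; exact haw (hc ▸ hb)⟩
    have hww' : w ≠ w' := fun h => by
      have := congrArg (fun t => t.1.length) h
      simp [ha] at this
    symm
    -- On the tree, deleting `w` and the later siblings of `w'` removes nothing strictly below `w'`.
    -- The corresponding deletions in `S` are recorded by `Survives`, so `hiff` for `a :: l` gives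
    -- the hypothesis at `w'`.
    refine ih _ w' _ hw'n ?_ ?_ ?_ ?_ ?_ ?_
    · rw [hend]
      exact haS
    · simp [hw'.1.1, hw'.1.2]
    · intro w'' hw'' b h
      simp only [Finset.mem_filter, Finset.mem_erase] at hw''
      rw [ha] at h
      exact hw''.1.1 (Subtype.ext (List.append_inj' h rfl).1.symm)
    · intro c hc hne
      rw [hend] at hne
      rw [ha] at hc
      simp only [Finset.mem_filter, Finset.mem_erase]
      simp only [List.mem_append, List.mem_singleton, hne, or_false] at hc
      rintro ⟨⟨h1, h2⟩, -⟩
      exact hdrop c hc h1 h2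
    · intro l b hl w'' hw''
      rw [hend] at hl ⊢
      have := hiff (a :: l) b ⟨hS, hl⟩ w'' (by rw [hw'', ha]; simp)
      have hne : w'' ≠ w := fun h => by
        have := congrArg (fun t => t.1.length) h
        simp [hw'', ha] at this
      simp only [List.cons_append, Survives, hS, true_and] at this
      rw [← this]
      simp only [Finset.mem_filter, Finset.mem_erase, hne, ne_eq, not_false_eq_true, true_and,
        and_iff_left_iff_imp, not_and]
      rintro - (⟨c, h⟩ | ⟨c, h⟩)
      · rw [hw'', ha] at h
        have := congrArg List.length h
        simp at this
      · rw [hw'', ha] at h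
        have := congrArg List.length h
        simp at this
    · refine (Finset.card_filter_le _ _).trans ?_
      rw [Finset.card_erase_of_mem hS]
      omega

/-! ### Finite-volume sums -/

theorem patch_of_mem {U S : Finset V} {y : V → Bool} {u : V} (hu : u ∈ U) :
    patch U S y u = true ↔ u ∈ S := by
  simp [patch, hu]

theorem patch_of_notMem {U S : Finset V} {y : V → Bool} {u : V} (hu : u ∉ U) :
    patch U S y u = y u := by
  simp [patch, hu]

theorem patch_congr {U : Finset V} (S : Finset V) {y z : V → Bool} (h : ∀ u ∉ U, y u = z u) :
    patch U S y = patch U S z := by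
  funext u
  by_cases hu : u ∈ U
  · simp [patch, hu]
  · simp [patch, hu, h u hu]

theorem patch_mem_indepSets_iff {G : SimpleGraph V} {U S : Finset V} (hS : S ⊆ U) {y : V → Bool}
    (hy : y ∈ indepSets G) : patch U S y ∈ indepSets G ↔
      (∀ u ∈ S, ∀ w ∈ S, ¬ G.Adj u w) ∧ ∀ u ∈ S, ∀ w ∉ U, G.Adj u w → y w = false := by
  constructor
  · intro h
    refine ⟨fun u hu w hw hadj => ?_, fun u hu w hw hadj => ?_⟩
    · have h1 := h u w hadj ((patch_of_mem (hS hu)).2 hu)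
      rw [(patch_of_mem (hS hw)).2 hw] at h1
      exact Bool.noConfusion h1
    · have h1 := h u w hadj ((patch_of_mem (hS hu)).2 hu)
      rwa [patch_of_notMem hw] at h1
  · rintro ⟨h1, h2⟩ u w hadj hu
    by_contra hw
    rw [Bool.not_eq_false] at hw
    by_cases huU : u ∈ U <;> by_cases hwU : w ∈ U
    · exact h1 u ((patch_of_mem huU).1 hu) w ((patch_of_mem hwU).1 hw) hadj
    · have := h2 u ((patch_of_mem huU).1 hu) w hwU hadj
      rw [patch_of_notMem hwU, this] at hw
      exact Bool.noConfusion hw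
    · have := h2 w ((patch_of_mem hwU).1 hw) u huU hadj.symm
      rw [patch_of_notMem huU, this] at hu
      exact Bool.noConfusion hu
    · rw [patch_of_notMem huU] at hu
      rw [patch_of_notMem hwU, hy u w hadj hu] at hw
      exact Bool.noConfusion hw

theorem weight_pos {lam : V → ℝ} (hlam : ∀ u, 0 < lam u) (U : Finset V) (x : V → Bool) :
    0 < weight lam U x :=
  Finset.prod_pos fun u _ => by split_ifs; exacts [hlam u, one_pos]

theorem weight_congr (lam : V → ℝ) {U : Finset V} {x y : V → Bool} (h : ∀ u ∈ U, x u = y u) :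
    weight lam U x = weight lam U y :=
  Finset.prod_congr rfl fun u hu => by rw [h u hu]

theorem weight_patch (lam : V → ℝ) {U S : Finset V} (hS : S ⊆ U) (y : V → Bool) :
    weight lam U (patch U S y) = ∏ u ∈ S, lam u := by
  classical
  unfold weight
  rw [← Finset.prod_filter]
  refine Finset.prod_congr ?_ fun _ _ => rfl
  ext u
  simp only [Finset.mem_filter]
  exact ⟨fun h => (patch_of_mem h.1).1 h.2, fun h => ⟨hS h, (patch_of_mem (hS h)).2 h⟩⟩

open Classical in
/-- The unnormalised expectation of `f` in the finite volume `U` with boundary condition `y`. -/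
def volumeSum (G : SimpleGraph V) (lam : V → ℝ) (U : Finset V) (y : V → Bool)
    (f : (V → Bool) → ℝ) : ℝ :=
  ∑ S ∈ U.powerset with patch U S y ∈ indepSets G, weight lam U (patch U S y) * f (patch U S y)

section

variable {G : SimpleGraph V} {lam : V → ℝ}

theorem volumeMass_eq_volumeSum (U : Finset V) (y : V → Bool) (A : Set (V → Bool)) :
    volumeMass G lam U y A = volumeSum G lam U y (A.indicator 1) := by
  classical
  simp only [volumeMass, volumeSum, Finset.sum_filter]
  refine Finset.sum_congr rfl fun S _ => ?_
  by_cases h1 : patch U S y ∈ indepSets G <;> by_cases h2 : patch U S y ∈ A <;> simp [h1, h2]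

theorem specification_eq_volumeSum (U : Finset V) (y : V → Bool) (A : Set (V → Bool)) :
    specification G lam U y A =
      volumeSum G lam U y (A.indicator 1) / volumeSum G lam U y 1 := by
  rw [specification, volumeMass_eq_volumeSum, volumeMass_eq_volumeSum, Set.indicator_univ]

theorem volumeSum_congr_boundary {U : Finset V} {y z : V → Bool} (h : ∀ u ∉ U, y u = z u)
    (f : (V → Bool) → ℝ) : volumeSum G lam U y f = volumeSum G lam U z f := by
  classical
  refine Finset.sum_congr (Finset.filter_congr fun S _ => ?_) fun S _ => ?_ <;>
    rw [patch_congr S h]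

theorem volumeSum_congr {U : Finset V} {y : V → Bool} {f g : (V → Bool) → ℝ}
    (h : ∀ z ∈ indepSets G, (∀ u ∉ U, z u = y u) → f z = g z) :
    volumeSum G lam U y f = volumeSum G lam U y g := by
  classical
  refine Finset.sum_congr rfl fun S hS => ?_
  rw [h _ (Finset.mem_filter.1 hS).2 fun u hu => patch_of_notMem hu]

theorem volumeSum_mono (hlam : ∀ u, 0 < lam u) {U : Finset V} {y : V → Bool}
    {f g : (V → Bool) → ℝ} (h : ∀ z ∈ indepSets G, (∀ u ∉ U, z u = y u) → f z ≤ g z) :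
    volumeSum G lam U y f ≤ volumeSum G lam U y g := by
  classical
  refine Finset.sum_le_sum fun S hS => ?_
  exact mul_le_mul_of_nonneg_left
    (h _ (Finset.mem_filter.1 hS).2 fun u hu => patch_of_notMem hu) (weight_pos hlam _ _).le

theorem volumeSum_const (U : Finset V) (y : V → Bool) (c : ℝ) :
    volumeSum G lam U y (fun _ => c) = volumeSum G lam U y 1 * c := by
  simp [volumeSum, Finset.sum_mul]

theorem volumeSum_pos (hlam : ∀ u, 0 < lam u) (U : Finset V) {y : V → Bool}
    (hy : y ∈ indepSets G) : 0 < volumeSum G lam U y 1 := by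
  classical
  refine Finset.sum_pos (fun S _ => by simpa using weight_pos hlam _ _) ⟨∅, ?_⟩
  simp [patch_mem_indepSets_iff (Finset.empty_subset U) hy]

/-- A subset of `E` splits into its parts outside and inside `D`. The outer sum needs no
independence condition, because the inner one tests the full configuration. -/
theorem volumeSum_eq_sum_sdiff [DecidableEq V] {D E : Finset V} (hDE : D ⊆ E) (y : V → Bool)
    (f : (V → Bool) → ℝ) : volumeSum G lam E y f =
      ∑ S ∈ (E \ D).powerset, weight lam (E \ D) (patch (E \ D) S y) *
        volumeSum G lam D (patch (E \ D) S y) f := by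
  classical
  simp only [volumeSum, Finset.sum_filter, Finset.mul_sum]
  rw [← Finset.sum_product']
  symm
  have hpatch : ∀ S₂ ⊆ E \ D, ∀ S₁ ⊆ D,
      patch E (S₂ ∪ S₁) y = patch D S₁ (patch (E \ D) S₂ y) := by
    intro S₂ h₂ S₁ h₁
    funext u
    by_cases hD : u ∈ D
    · have : u ∉ S₂ := fun h => (Finset.mem_sdiff.1 (h₂ h)).2 hD
      simp [patch, hD, hDE hD, this]
    · have : u ∉ S₁ := fun h => hD (h₁ h)
      by_cases hE : u ∈ E <;> simp [patch, hD, hE, this]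
  refine Finset.sum_nbij' (fun p => p.1 ∪ p.2) (fun S => (S \ D, S ∩ D)) ?_ ?_ ?_ ?_ ?_
  · rintro ⟨S₂, S₁⟩ h
    simp only [Finset.mem_product, Finset.mem_powerset] at h ⊢
    exact Finset.union_subset (h.1.trans Finset.sdiff_subset) (h.2.trans hDE)
  · intro S h
    simp only [Finset.mem_product, Finset.mem_powerset] at h ⊢
    exact ⟨Finset.sdiff_subset_sdiff h subset_rfl, Finset.inter_subset_right⟩
  · rintro ⟨S₂, S₁⟩ h
    simp only [Finset.mem_product, Finset.mem_powerset] at h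
    ext u
    · have h1 := @h.1 u
      have h2 := @h.2 u
      simp only [Finset.mem_sdiff, Finset.mem_union] at h1 ⊢
      tauto
    · have h1 := @h.1 u
      have h2 := @h.2 u
      simp only [Finset.mem_sdiff, Finset.mem_inter, Finset.mem_union] at h1 ⊢
      tauto
  · intro S h
    exact Finset.sdiff_union_inter S D
  · rintro ⟨S₂, S₁⟩ h
    simp only [Finset.mem_product, Finset.mem_powerset] at h
    simp only
    rw [hpatch S₂ h.1 S₁ h.2]
    have hw : weight lam E (patch D S₁ (patch (E \ D) S₂ y)) =
        weight lam (E \ D) (patch (E \ D) S₂ y) *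
          weight lam D (patch D S₁ (patch (E \ D) S₂ y)) := by
      rw [weight_congr lam (U := E \ D) (y := patch D S₁ (patch (E \ D) S₂ y)) fun u hu =>
        (patch_of_notMem (Finset.mem_sdiff.1 hu).2).symm]
      exact (Finset.prod_sdiff hDE).symm
    rw [hw]
    split_ifs <;> ring

/-- Consistency of the finite-volume distributions. -/
theorem volumeSum_volumeSum (hlam : ∀ u, 0 < lam u) {D E : Finset V} (hDE : D ⊆ E)
    (y : V → Bool) (f : (V → Bool) → ℝ) :
    volumeSum G lam E y (fun z => volumeSum G lam D z f / volumeSum G lam D z 1) =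
      volumeSum G lam E y f := by
  classical
  rw [volumeSum_eq_sum_sdiff hDE, volumeSum_eq_sum_sdiff hDE]
  refine Finset.sum_congr rfl fun S _ => ?_
  congr 1
  set y' := patch (E \ D) S y
  rw [volumeSum_congr (g := fun _ => volumeSum G lam D y' f / volumeSum G lam D y' 1)
    fun z _ hz => by rw [volumeSum_congr_boundary hz, volumeSum_congr_boundary hz],
    volumeSum_const]
  -- The intermediate boundary condition `y'` need not be independent. If its partition function
  -- vanishes, no configuration is admissible and both sides are zero.
  by_cases h : volumeSum G lam D y' 1 = 0
  · rw [h, zero_mul]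
    have h0 : ∀ S ∈ D.powerset.filter fun S => patch D S y' ∈ indepSets G, False := by
      intro S hS
      have := (Finset.sum_eq_zero_iff_of_nonneg
        (fun S _ => by simpa using (weight_pos hlam _ _).le)).1 h S hS
      simp [(weight_pos hlam D (patch D S y')).ne'] at this
    rw [volumeSum]
    exact (Finset.sum_eq_zero fun S hS => (h0 S hS).elim).symm
  · field_simp

/-- By consistency the law in `E` is an average of laws in `D`, so a uniform bound for `D` carries
over. -/
theorem abs_specification_sub_le (hlam : ∀ u, 0 < lam u) {D E : Finset V} (hDE : D ⊆ E)
    {y : V → Bool} (hy : y ∈ indepSets G) {A : Set (V → Bool)} {q ε : ℝ}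
    (h : ∀ z ∈ indepSets G, (∀ u ∉ E, z u = y u) → |specification G lam D z A - q| ≤ ε) :
    |specification G lam E y A - q| ≤ ε := by
  have hpos := volumeSum_pos hlam E hy
  rw [specification_eq_volumeSum, ← volumeSum_volumeSum hlam hDE]
  simp only [← specification_eq_volumeSum]
  have h1 := volumeSum_mono (G := G) hlam (U := E) (y := y)
    (f := fun z => specification G lam D z A) (g := fun _ => q + ε)
    fun z hz hzy => by linarith [(abs_le.1 (h z hz hzy)).2]
  have h2 := volumeSum_mono (G := G) hlam (U := E) (y := y)
    (g := fun z => specification G lam D z A) (f := fun _ => q - ε)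
    fun z hz hzy => by linarith [(abs_le.1 (h z hz hzy)).1]
  rw [volumeSum_const] at h1 h2
  rw [abs_le]
  constructor
  · have := (le_div_iff₀ hpos).2 ((mul_comm _ _).trans_le h2)
    linarith
  · have := (div_le_iff₀ hpos).2 (h1.trans_eq (mul_comm _ _))
    linarith

theorem specification_congr_boundary {U : Finset V} {y z : V → Bool} (h : ∀ u ∉ U, y u = z u)
    (A : Set (V → Bool)) : specification G lam U y A = specification G lam U z A := by
  rw [specification_eq_volumeSum, specification_eq_volumeSum, volumeSum_congr_boundary h,
    volumeSum_congr_boundary h]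

theorem specification_nonneg (hlam : ∀ u, 0 < lam u) (U : Finset V) {y : V → Bool}
    (A : Set (V → Bool)) : 0 ≤ specification G lam U y A := by
  unfold specification volumeMass
  exact div_nonneg (Finset.sum_nonneg fun S _ => (weight_pos hlam _ _).le)
    (Finset.sum_nonneg fun S _ => (weight_pos hlam _ _).le)

theorem specification_le_one (hlam : ∀ u, 0 < lam u) (U : Finset V) {y : V → Bool}
    (hy : y ∈ indepSets G) (A : Set (V → Bool)) : specification G lam U y A ≤ 1 := by
  rw [specification_eq_volumeSum, div_le_one (volumeSum_pos hlam U hy)]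
  exact volumeSum_mono hlam fun z _ _ => Set.indicator_le_self' (fun _ _ => zero_le_one) z

open Classical in
theorem specification_of_notMem (hlam : ∀ u, 0 < lam u) {U : Finset V} {v : V} (hv : v ∉ U)
    {y : V → Bool} (hy : y ∈ indepSets G) :
    specification G lam U y {s | s v = false} = if y v = false then 1 else 0 := by
  rw [specification_eq_volumeSum,
    volumeSum_congr (g := fun _ => if y v = false then 1 else 0), volumeSum_const,
    mul_div_cancel_left₀ _ (volumeSum_pos hlam U hy).ne']
  intro z _ hz
  simp [Set.indicator_apply, hz v hv]

open Classical in
/-- The vertices of `U` that have no occupied neighbour in the boundary condition `y` off `U`. -/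
def allowed (G : SimpleGraph V) (U : Finset V) (y : V → Bool) : Finset V :=
  U.filter fun u => ∀ w ∉ U, G.Adj u w → y w = false

theorem mem_allowed {U : Finset V} {y : V → Bool} {u : V} :
    u ∈ allowed G U y ↔ u ∈ U ∧ ∀ w ∉ U, G.Adj u w → y w = false := by
  simp [allowed]

/-- An independent boundary condition acts only by forbidding the vertices next to its occupied
ones; what remains is the free model on `allowed`. -/
theorem specification_eq_unoccProb {U : Finset V} {v : V} (hv : v ∈ U) {y : V → Bool}
    (hy : y ∈ indepSets G) :
    specification G lam U y {s | s v = false} = unoccProb G lam v (allowed G U y) := by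
  classical
  have key : ∀ (A : Set (V → Bool)) (S : Finset V), S ⊆ allowed G U y →
      (∀ I ⊆ allowed G U y, patch U I y ∈ A ↔ I ⊆ S) →
      volumeMass G lam U y A = indepSum G lam S := by
    intro A S hS hA
    unfold volumeMass indepSum
    refine Finset.sum_congr ?_ ?_
    · ext I
      simp only [Finset.mem_filter, Finset.mem_powerset, Set.mem_inter_iff]
      constructor
      · rintro ⟨hIU, hI, hIA⟩
        rw [patch_mem_indepSets_iff hIU hy] at hI
        exact ⟨(hA I fun u hu => mem_allowed.2 ⟨hIU hu, hI.2 u hu⟩).1 hIA, hI.1⟩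
      · rintro ⟨hIS, hI⟩
        have hIU : I ⊆ U := fun u hu => (mem_allowed.1 (hS (hIS hu))).1
        refine ⟨hIU, (patch_mem_indepSets_iff hIU hy).2
          ⟨hI, fun u hu => (mem_allowed.1 (hS (hIS hu))).2⟩, (hA I (hIS.trans hS)).2 hIS⟩
    · intro I hI
      simp only [Finset.mem_filter, Finset.mem_powerset] at hI
      exact weight_patch lam (fun u hu => (mem_allowed.1 (hS (hI.1 hu))).1) y
  rw [specification, unoccProb, key _ _ (Finset.erase_subset v _), key _ _ subset_rfl]
  · intro I hI
    simpa using hI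
  · intro I hI
    simp only [Set.mem_ofPred_eq, Finset.subset_erase, hI, true_and, ← Bool.not_eq_true,
      patch_of_mem hv]

theorem unoccProb_of_notMem (hlam : ∀ u, 0 < lam u) {S : Finset V} {v : V} (hv : v ∉ S) :
    unoccProb G lam v S = 1 := by
  classical
  rw [unoccProb, Finset.erase_eq_of_notMem hv, div_self (indepSum_pos G hlam S).ne']

/-- The finite-volume distribution depends on the boundary condition through the vertices that
have a neighbour in the volume. -/
theorem specification_congr_of_adj {U : Finset V} {y z : V → Bool} (hy : y ∈ indepSets G)
    (hz : z ∈ indepSets G) (h : ∀ u ∈ U, ∀ w ∉ U, G.Adj u w → y w = z w) {U' : Finset V}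
    (hU' : U' ⊆ U) (x : V → Bool) :
    specification G lam U y {s | ∀ u ∈ U', s u = x u} =
      specification G lam U z {s | ∀ u ∈ U', s u = x u} := by
  classical
  have key : ∀ A : Set (V → Bool), (∀ S ⊆ U, patch U S y ∈ A ↔ patch U S z ∈ A) →
      volumeMass G lam U y A = volumeMass G lam U z A := by
    intro A hA
    unfold volumeMass
    refine Finset.sum_congr (Finset.filter_congr fun S hS => ?_) ?_
    · rw [Finset.mem_powerset] at hS
      rw [Set.mem_inter_iff, Set.mem_inter_iff, hA S hS, patch_mem_indepSets_iff hS hy,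
        patch_mem_indepSets_iff hS hz]
      refine and_congr_left fun _ => and_congr_right fun _ => ?_
      exact forall₂_congr fun u hu => forall₃_congr fun w hw hadj => by
        rw [h u (hS hu) w hw hadj]
    · intro S hS
      simp only [Finset.mem_filter, Finset.mem_powerset] at hS
      rw [weight_patch lam hS.1, weight_patch lam hS.1]
  rw [specification, specification, key _ ?_, key Set.univ (by simp)]
  intro S _
  simp only [Set.mem_ofPred_eq]
  refine forall₂_congr fun u hu => ?_
  simp [patch, hU' hu]

end

/-! ### The finite-volume identity between a graph and its tree of self-avoiding walks -/

section

variable {G : SimpleGraph V} {lam : V → ℝ} {v : V}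

theorem SAWVertex.isTrailFrom (w : SAWVertex G v) : IsTrailFrom G v w.1 := by
  rcases w.2 with h | h <;> exact h.1

theorem SAWVertex.mem_closingTrails (w : SAWVertex G v) (hw : ¬ w.1.Nodup) :
    w.1 ∈ closingTrails G v := by
  rcases w.2 with h | h
  exacts [(hw h.2).elim, h]

/-- The closing edge is new: `b` occurs only at the end of `w`, so the only earlier edge at `b`
comes from its predecessor, and that is not `c` because `a` lies in between. -/
theorem append_singleton_mem_closingTrails {w : SAWVertex G v} {p q : List V} {c a b : V}
    (hw : w.1.Nodup) (h : w.1 = p ++ c :: a :: (q ++ [b])) (hadj : G.Adj c b) :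
    w.1 ++ [c] ∈ closingTrails G v := by
  have hT := w.isTrailFrom
  have hend : sawEnd w = b :=
    sawEnd_of_eq_append (l := p ++ c :: a :: q) (by rw [h]; simp)
  refine ⟨⟨?_, ?_, ?_⟩, ?_, by simpa using hw⟩
  · rw [List.head?_append_of_ne_nil _ w.ne_nil, hT.head_eq]
  · rw [List.isChain_append]
    refine ⟨hT.chain, by simp, ?_⟩
    intro x hx y hy
    rw [List.getLast?_eq_some_getLast w.ne_nil] at hx
    simp at hx hy
    subst hx hy
    change G.Adj (sawEnd w) c
    rw [hend]
    exact hadj.symm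
  · have hm : p ++ c :: a :: q ≠ [] := by simp
    have h1 : w.1 = (p ++ c :: a :: q).dropLast ++
        [(p ++ c :: a :: q).getLast hm, b] := by
      rw [h]
      conv_rhs => rw [show ∀ x y : V, [x, y] = [x] ++ [y] from fun _ _ => rfl, ← List.append_assoc,
        List.dropLast_append_getLast hm]
      simp
    set b' := (p ++ c :: a :: q).getLast hm with hb'
    set m := (p ++ c :: a :: q).dropLast with hm'
    have hmb : m ++ [b'] = p ++ c :: a :: q := List.dropLast_append_getLast hm
    have hbm : b ∉ m ++ [b'] := by
      rw [h1, show [b', b] = [b'] ++ [b] from rfl, ← List.append_assoc] at hw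
      intro hb
      exact (List.disjoint_of_nodup_append hw) hb (by simp)
    have hcb : c ≠ b' := by
      intro hc
      have hbq : b' ∈ a :: q := by
        rw [hb', List.getLast_append_of_ne_nil _ (by simp), List.getLast_cons (by simp)]
        exact List.getLast_mem _
      rw [h, show p ++ c :: a :: (q ++ [b]) = p ++ ((c :: a :: q) ++ [b]) by simp] at hw
      have h2 := (List.nodup_append.1 (List.nodup_append.1 hw).2.1).1
      exact (List.nodup_cons.1 h2).1 (hc ▸ hbq)
    have hen := edges_nodup_of_nodup hw
    rw [h1] at hen ⊢
    rw [show m ++ [b', b] ++ [c] = (m ++ [b']) ++ [b, c] by simp, edges_append_pair,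
      show m ++ [b'] ++ [b] = m ++ [b', b] by simp]
    rw [List.nodup_append]
    refine ⟨hen, by simp, ?_⟩
    intro e he e' he'
    rw [List.mem_singleton] at he'
    rintro rfl
    subst he'
    rw [edges_append_pair, List.mem_append] at he
    rcases he with he | he
    · exact hbm (mem_of_mem_edges he (by simp))
    · simp only [List.mem_singleton, Sym2.eq_iff] at he
      rcases he with ⟨h3, -⟩ | ⟨-, h3⟩
      · exact hbm (by simp [h3])
      · exact hcb h3
  · rw [h]
    simp [List.nodup_append]

theorem mem_sawCondSet_of_sawEnd_mem {w : SAWVertex G v} {U : Set V} (h : sawEnd w ∈ U) :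
    w ∈ sawCondSet G v U :=
  Or.inl h

theorem sawCondValue_of_mem (idx : V → V → ℕ) (x : V → Bool) {w : SAWVertex G v} {U : Set V}
    (h : sawEnd w ∈ U) : sawCondValue G idx v x U w = x (sawEnd w) := by
  rw [sawCondValue, if_pos h]

/-- This is where tags become deletions. An extension of `w` by a vertex off `W` carries the value
of `y` there, and a closing extension inside `W` carries its tag; between them they block `w`
exactly when the walk leaves `allowed G W y` or violates the ordering. The volume `E` may exceed the
simple trails in `W`, as `hl` confines attention to trails with an unblocked parent. -/
theorem mem_allowed_sawTree_iff {idx : V → V → ℕ} {W : Finset V} {y : V → Bool}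
    {E : Finset (SAWVertex G v)} {η : SAWVertex G v → Bool}
    (hE : ∀ w : SAWVertex G v, w.1.Nodup → (∀ c ∈ w.1, c ∈ W) → w ∈ E)
    (hEC : ∀ w ∈ E, w ∉ sawCondSet G v {c | c ∉ W})
    (hηC : ∀ w ∈ sawCondSet G v {c | c ∉ W}, η w = sawCondValue G idx v y {c | c ∉ W} w)
    {w : SAWVertex G v} {l : List V} {a : V} (hw : w.1 = l ++ [a])
    (hl : IsOrderedPath G idx (allowed G W y) l) :
    w ∈ allowed (sawTree G v) E η ↔ IsOrderedPath G idx (allowed G W y) w.1 := by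
  have hend := sawEnd_of_eq_append hw
  have hlW : ∀ c ∈ l, c ∈ W := fun c hc => (mem_allowed.1 (hl.2.1 c hc)).1
  constructor
  · intro hR
    obtain ⟨hwE, hnb⟩ := mem_allowed.1 hR
    have haW : a ∈ W := by
      by_contra h
      exact hEC w hwE (mem_sawCondSet_of_sawEnd_mem (hend ▸ h))
    have hwW : ∀ c ∈ w.1, c ∈ W := by
      intro c hc
      rw [hw, List.mem_append, List.mem_singleton] at hc
      rcases hc with hc | rfl
      exacts [hlW c hc, haW]
    have hn : w.1.Nodup := by
      by_contra h
      exact hEC w hwE (Or.inr ⟨w.mem_closingTrails h, fun c hc => by simpa using hwW c hc⟩)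
    refine ⟨hn, ?_, ?_⟩
    · intro c hc
      rw [hw, List.mem_append, List.mem_singleton] at hc
      rcases hc with hc | rfl
      · exact hl.2.1 c hc
      · refine mem_allowed.2 ⟨haW, fun d hd hadj => ?_⟩
        have hmem := append_singleton_mem_simpleTrails hn (a := d) (by rwa [hend])
          fun h => hd (hwW d h)
        let w' : SAWVertex G v := ⟨_, Or.inl hmem⟩
        have hend' : sawEnd w' = d := sawEnd_of_eq_append rfl
        have hdU : sawEnd w' ∈ {c | c ∉ W} := hend'.symm ▸ hd
        have hC : w' ∈ sawCondSet G v {c | c ∉ W} := mem_sawCondSet_of_sawEnd_mem hdU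
        have h1 := hnb w' (fun h => hEC w' h hC) (Or.inl ⟨d, rfl⟩)
        rw [hηC w' hC, sawCondValue_of_mem idx y hdU, hend'] at h1
        exact h1
    · intro p c a' q b r h hadj hlt
      -- If `b` is the last vertex of `w`, the closing extension by `c` would be tagged occupied,
      -- contradicting `hnb`. Otherwise the violation already occurs in `l`.
      rcases List.eq_nil_or_concat r with rfl | ⟨r, d, rfl⟩
      · have hab : b = a := by
          rw [← hend]
          exact (sawEnd_of_eq_append (l := p ++ c :: a' :: q) (by rw [h]; simp)).symm
        have hmem := append_singleton_mem_closingTrails hn h hadj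
        let w' : SAWVertex G v := ⟨_, Or.inr hmem⟩
        have hend' : sawEnd w' = c := sawEnd_of_eq_append rfl
        have hcW : c ∈ W := hwW c (by rw [h]; simp)
        have hC : w' ∈ sawCondSet G v {c | c ∉ W} := by
          refine Or.inr ⟨hmem, fun d hd => ?_⟩
          have : d ∈ w.1 ∨ d = c := by simpa [w'] using hd
          rcases this with hd | rfl
          · simpa using hwW d hd
          · simpa using hcW
        have h1 := hnb w' (fun h => hEC w' h hC) (Or.inl ⟨c, rfl⟩)
        rw [hηC w' hC, sawCondValue, hend', if_neg (by simpa using hcW)] at h1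
        simp only [decide_eq_false_iff_not] at h1
        exact h1 ⟨p, c, a', q, b, by simp [w', h], hlt⟩
      · refine hl.2.2 p c a' q b r ?_ hadj hlt
        rw [hw] at h
        exact (List.append_inj' (t₁ := [a]) (s₂ := p ++ c :: a' :: (q ++ b :: r)) (t₂ := [d])
          (by rw [h]; simp) rfl).1
  · intro hG
    have hwW : ∀ c ∈ w.1, c ∈ W := fun c hc => (mem_allowed.1 (hG.2.1 c hc)).1
    refine mem_allowed.2 ⟨hE w hG.1 hwW, ?_⟩
    rintro w' hw' (⟨c, hc⟩ | ⟨c, hc⟩)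
    · have hend' := sawEnd_of_eq_append hc
      have hadj := adj_sawEnd_of_eq_append hc
      rw [hend] at hadj
      by_cases hcW : c ∈ W
      · have hw'W : ∀ d ∈ w'.1, d ∈ W := by
          intro d hd
          rw [hc, List.mem_append, List.mem_singleton] at hd
          rcases hd with hd | rfl
          exacts [hwW d hd, hcW]
        -- A trail inside `W` but off `E` cannot be simple.
        have hcl := w'.mem_closingTrails fun h => hw' (hE w' h hw'W)
        rw [hηC w' (Or.inr ⟨hcl, fun d hd => by simpa using hw'W d hd⟩), sawCondValue, hend',
          if_neg (by simpa using hcW), decide_eq_false_iff_not]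
        rintro ⟨p, u, a', q, b, h, hlt⟩
        rw [hc] at h
        have h2 := List.append_inj' (t₁ := [c]) (s₂ := p ++ u :: a' :: (q ++ b :: [])) (t₂ := [u])
          (by rw [h]; simp) rfl
        have hcu : c = u := by simpa using h2.2
        have hab : a = b := by
          rw [← hend]
          exact sawEnd_of_eq_append (l := p ++ u :: a' :: q) (by rw [h2.1]; simp)
        exact hG.2.2 p u a' q b [] h2.1 (by rw [← hcu, ← hab]; exact hadj.symm) hlt
      · have hcU : sawEnd w' ∈ {c | c ∉ W} := hend' ▸ hcW
        rw [hηC w' (mem_sawCondSet_of_sawEnd_mem hcU), sawCondValue_of_mem idx y hcU, hend']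
        exact (mem_allowed.1 (hG.2.1 a (by simp [hw]))).2 c hcW hadj
    -- The parent is a simple trail in `W`, hence in `E`, so it is no boundary vertex.
    · rw [hw] at hc
      have h1 := (List.append_inj' hc rfl).1
      exact (hw' (hE w' (h1 ▸ hl.1) (h1 ▸ hlW))).elim

/-- The probability that `v` is unoccupied in a finite volume agrees with the probability that the
root is unoccupied in a corresponding finite volume of the tree of self-avoiding walks. -/
theorem specification_eq_specification_sawTree (hlam : ∀ u, 0 < lam u) {idx : V → V → ℕ}
    (hidx : ∀ u, Set.InjOn (idx u) (G.neighborSet u)) {W : Finset V} {y : V → Bool}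
    (hy : y ∈ indepSets G) {E : Finset (SAWVertex G v)} {η : SAWVertex G v → Bool}
    (hη : η ∈ indepSets (sawTree G v))
    (hE : ∀ w : SAWVertex G v, w.1.Nodup → (∀ c ∈ w.1, c ∈ W) → w ∈ E)
    (hEC : ∀ w ∈ E, w ∉ sawCondSet G v {c | c ∉ W})
    (hηC : ∀ w ∈ sawCondSet G v {c | c ∉ W}, η w = sawCondValue G idx v y {c | c ∉ W} w) :
    specification G lam W y {s | s v = false} =
      specification (sawTree G v) (sawActivity G lam v) E η {s | s (sawRoot G v) = false} := by
  have hlamT : ∀ w, 0 < sawActivity G lam v w := fun _ => hlam _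
  by_cases hv : v ∈ W
  · have key : ∀ (w : SAWVertex G v) (l : List V) (a : V), w.1 = l ++ [a] →
        IsOrderedPath G idx (allowed G W y) l →
        (w ∈ allowed (sawTree G v) E η ↔ IsOrderedPath G idx (allowed G W y) w.1) :=
      fun w l a hw hl => mem_allowed_sawTree_iff hE hEC hηC hw hl
    have hroot : sawRoot G v ∈ allowed (sawTree G v) E η ↔ v ∈ allowed G W y := by
      rw [key (sawRoot G v) [] v rfl ⟨by simp, by simp, by simp⟩]
      exact (survives_iff G idx v (allowed G W y) []).symm
    rw [specification_eq_unoccProb hv hy, specification_eq_unoccProb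
      (hE _ (by simp [sawRoot]) (by simpa [sawRoot] using hv)) hη]
    by_cases hS : v ∈ allowed G W y
    · refine unoccProb_eq_unoccProb_sawTree G hlam hidx v _ (sawRoot G v) _ (by simp [sawRoot]) hS
        (hroot.2 hS) ?_ (fun c hc hne => (hne (List.mem_singleton.1 hc)).elim) ?_
      · intro w' _ a h
        have := congrArg List.length h
        simp [sawRoot] at this
        exact w'.ne_nil this
      · intro l a hl w' hw'
        rw [survives_iff] at hl ⊢
        rw [key w' (v :: l) a hw' hl, hw']
        rfl
    · rw [unoccProb_of_notMem hlam hS, unoccProb_of_notMem hlamT fun h =>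
        hS (hroot.1 h)]
  · have hC : sawRoot G v ∈ sawCondSet G v {c | c ∉ W} := Or.inl hv
    rw [specification_of_notMem hlam hv hy, specification_of_notMem hlamT
      (fun h => hEC _ h hC) hη, hηC _ hC, sawCondValue_of_mem idx y hv]
    rfl

/-! ### The tree of self-avoiding walks as a graph -/

theorem sawTree_neighborSet_finite (hG : ∀ u, (G.neighborSet u).Finite) (w : SAWVertex G v) :
    ((sawTree G v).neighborSet w).Finite := by
  have hfin : ((fun a => w.1 ++ [a]) '' G.neighborSet (sawEnd w) ∪ {w.1.dropLast}).Finite :=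
    ((hG _).image _).union (Set.finite_singleton _)
  refine (hfin.preimage (f := Subtype.val) Subtype.val_injective.injOn).subset ?_
  rintro w' (⟨a, h⟩ | ⟨a, h⟩)
  · exact Or.inl ⟨a, adj_sawEnd_of_eq_append h, h.symm⟩
  · exact Or.inr (by simp [h])

theorem sawTree_preconnected : (sawTree G v).Preconnected := by
  have key : ∀ n, ∀ w : SAWVertex G v, w.1.length = n →
      (sawTree G v).Reachable (sawRoot G v) w := by
    intro n
    induction n with
    | zero => exact fun w hw => (w.ne_nil (List.length_eq_zero_iff.1 hw)).elim
    | succ n ih =>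
      intro w hw
      have hT := w.isTrailFrom
      have hdl := List.dropLast_append_getLast w.ne_nil
      by_cases hnil : w.1.dropLast = []
      · rw [hnil] at hdl
        have h1 := hT.head_eq
        rw [← hdl] at h1
        have : sawRoot G v = w := Subtype.ext (by rw [← hdl]; simp [sawRoot] at h1 ⊢; exact h1.symm)
        exact this ▸ SimpleGraph.Reachable.refl _
      · have hmem : w.1.dropLast ∈ simpleTrails G v := by
          refine mem_simpleTrails.2 ⟨?_, hT.chain.dropLast, ?_⟩
          · rw [← hT.head_eq]
            conv_rhs => rw [← hdl, List.head?_append_of_ne_nil _ hnil]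
          · rcases w.2 with h | h
            exacts [h.2.sublist (List.dropLast_sublist _), h.2.2]
        let w' : SAWVertex G v := ⟨_, Or.inl hmem⟩
        refine (ih w' (by simp [w', hw])).trans (SimpleGraph.Adj.reachable ?_)
        exact Or.inl ⟨_, hdl.symm⟩
  exact fun w w' => (key _ w rfl).symm.trans (key _ w' rfl)

end

/-! ### Decay of correlations -/

/-- The finite-volume probability that `u` is unoccupied is determined up to `ε` by the boundary
condition on a finite set. -/
def HasDecay (G : SimpleGraph V) (lam : V → ℝ) : Prop :=
  ∀ (u : V) (ε : ℝ), 0 < ε → ∃ B : Finset V, u ∈ B ∧ ∀ D : Finset V, ∀ y ∈ indepSets G,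
    ∀ z ∈ indepSets G, (∀ w ∈ B, w ∉ D → y w = z w) →
      |specification G lam D y {s | s u = false} -
        specification G lam D z {s | s u = false}| ≤ ε

theorem exists_finset_edist_le {G : SimpleGraph V} (hG : ∀ u, (G.neighborSet u).Finite) (u : V)
    (n : ℕ) : ∃ B : Finset V, ∀ w, G.edist u w ≤ n → w ∈ B := by
  classical
  induction n with
  | zero =>
    refine ⟨{u}, fun w hw => ?_⟩
    have : G.edist u w = 0 := by simpa using hw
    simpa using (SimpleGraph.edist_eq_zero_iff.1 this).symm
  | succ n ih =>
    obtain ⟨B, hB⟩ := ih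
    refine ⟨B ∪ B.biUnion fun w => (hG w).toFinset, fun w hw => ?_⟩
    have hne : G.edist u w ≠ ⊤ := fun h => by simp [h] at hw
    obtain ⟨p, hp⟩ := G.exists_walk_of_edist_ne_top hne
    rw [← hp] at hw
    have hlen : p.length ≤ n + 1 := by exact_mod_cast hw
    rw [Finset.mem_union, Finset.mem_biUnion]
    cases hpn : p.reverse with
    | nil => exact Or.inl (hB _ (by simp))
    | cons hadj q =>
      rename_i c
      refine Or.inr ⟨c, hB c ?_, by simpa using hadj.symm⟩
      have h1 : q.length + 1 = p.length := by
        rw [← SimpleGraph.Walk.length_reverse p, hpn, SimpleGraph.Walk.length_cons]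
      refine (G.edist_le q.reverse).trans ?_
      rw [SimpleGraph.Walk.length_reverse]
      exact_mod_cast (by omega : q.length ≤ n)

/-- Local finiteness makes a large ball around `u` finite. Connectedness keeps the distance to a
disagreement finite, the case that `StrongSpatialMixing` covers. -/
theorem StrongSpatialMixing.hasDecay {G : SimpleGraph V} {lam : V → ℝ} (hlam : ∀ u, 0 < lam u)
    (hG : ∀ u, (G.neighborSet u).Finite) (hconn : G.Preconnected)
    (h : StrongSpatialMixing G lam) : HasDecay G lam := by
  obtain ⟨δ, -, hδ, h⟩ := h
  intro u ε hε
  obtain ⟨N, hN⟩ := eventually_atTop.1 (hδ.eventually_le_const hε)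
  obtain ⟨B, hB⟩ := exists_finset_edist_le hG u N
  refine ⟨B, hB u (by simp), fun D y hy z hz hyz => ?_⟩
  by_cases hD : ∃ w, w ∈ disagreement D y z
  · obtain ⟨w, hw⟩ := hD
    by_cases hu : u ∈ D
    · have hle : distToSet G u (disagreement D y z) ≤ G.edist u w := iInf₂_le w hw
      have hne : distToSet G u (disagreement D y z) ≠ ⊤ :=
        ne_top_of_le_ne_top (SimpleGraph.edist_ne_top_iff_reachable.2 (hconn u w)) hle
      obtain ⟨n, hn⟩ := ENat.ne_top_iff_exists.1 hne
      refine (h D u hu y hy z hz n hn.symm).trans (hN n ?_)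
      have : (N : ℕ∞) ≤ distToSet G u (disagreement D y z) := by
        refine le_iInf₂ fun w hw => le_of_not_ge fun hle => ?_
        exact hw.2 (hyz w (hB w hle) hw.1)
      rw [← hn] at this
      exact_mod_cast this
    · rw [specification_of_notMem hlam hu hy, specification_of_notMem hlam hu hz,
        hyz u (hB u (by simp)) hu, sub_self, abs_zero]
      exact hε.le
  · have : ∀ w ∉ D, y w = z w := fun w hw => by
      by_contra hne
      exact hD ⟨w, hw, hne⟩
    rw [specification_congr_boundary this, sub_self, abs_zero]
    exact hε.le

theorem hasDecay_sawTree {G : SimpleGraph V} (hG : ∀ u, (G.neighborSet u).Finite) {lam : V → ℝ}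
    (hlam : ∀ u, 0 < lam u) {v : V}
    (h : StrongSpatialMixing (sawTree G v) (sawActivity G lam v)) :
    HasDecay (sawTree G v) (sawActivity G lam v) :=
  h.hasDecay (fun _ => hlam _) (sawTree_neighborSet_finite hG) sawTree_preconnected

/-! ### Cylinder events and local functions -/

section

variable {G : SimpleGraph V}

theorem measurable_eval (G : SimpleGraph V) (u : V) :
    Measurable fun z : indepSets G => z.1 u :=
  (measurable_pi_apply u).comp measurable_subtype_coe

theorem measurable_eval_outsideSigma {U : Finset V} {u : V} (hu : u ∉ U) :
    Measurable[outsideSigma G U] fun z : indepSets G => z.1 u :=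
  (measurable_pi_apply (⟨u, hu⟩ : {u : V // u ∉ U})).comp
    (comap_measurable fun (z : indepSets G) (u : {u : V // u ∉ U}) => z.1 u.1)

theorem outsideSigma_le (G : SimpleGraph V) (U : Finset V) :
    outsideSigma G U ≤ (inferInstance : MeasurableSpace (indepSets G)) :=
  Measurable.comap_le (measurable_pi_lambda _ fun u => measurable_eval G u.1)

theorem measurableSet_cylinder_of_eval {m : MeasurableSpace (indepSets G)} (x : V → Bool)
    (F : Finset V) (h : ∀ u ∈ F, Measurable[m] fun z : indepSets G => z.1 u) :
    MeasurableSet[m] (cylinder G x F) := by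
  have : cylinder G x F = ⋂ u ∈ F, (fun z : indepSets G => z.1 u) ⁻¹' {x u} := by
    ext z
    simp [cylinder]
  rw [this]
  exact Finset.measurableSet_biInter F fun u hu => h u hu (measurableSet_singleton _)

theorem measurableSet_cylinder (G : SimpleGraph V) (x : V → Bool) (F : Finset V) :
    MeasurableSet (cylinder G x F) :=
  measurableSet_cylinder_of_eval x F fun u _ => measurable_eval G u

theorem measurableSet_cylinder_outsideSigma {U : Finset V} (x : V → Bool) {F : Finset V}
    (hF : ∀ u ∈ F, u ∉ U) : MeasurableSet[outsideSigma G U] (cylinder G x F) :=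
  measurableSet_cylinder_of_eval x F fun _ hu => measurable_eval_outsideSigma (hF _ hu)

theorem unoccupied_eq_cylinder (G : SimpleGraph V) (v : V) :
    unoccupied G v = cylinder G (fun _ => false) ({v} : Finset V) := by
  ext z
  simp [unoccupied, cylinder]

theorem measurableSet_unoccupied (G : SimpleGraph V) (v : V) : MeasurableSet (unoccupied G v) :=
  unoccupied_eq_cylinder G v ▸ measurableSet_cylinder G _ _

/-- The cylinder events on finite sets of vertices that satisfy `p`. -/
def cylinders (G : SimpleGraph V) (p : V → Prop) : Set (Set (indepSets G)) :=
  {A | ∃ (x : V → Bool) (F : Finset V), (∀ u ∈ F, p u) ∧ A = cylinder G x F}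

theorem isPiSystem_cylinders (G : SimpleGraph V) (p : V → Prop) : IsPiSystem (cylinders G p) := by
  classical
  rintro _ ⟨x, F, hF, rfl⟩ _ ⟨x', F', hF', rfl⟩ ⟨z, hz, hz'⟩
  refine ⟨z.1, F ∪ F', fun u hu => (Finset.mem_union.1 hu).elim (hF u) (hF' u), ?_⟩
  ext s
  simp only [cylinder, Set.mem_inter_iff, Set.mem_ofPred_eq, Finset.coe_union, Set.mem_union,
    Finset.mem_coe]
  constructor
  · rintro ⟨h, h'⟩ u (hu | hu)
    exacts [(h u hu).trans (hz u hu).symm, (h' u hu).trans (hz' u hu).symm]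
  · intro h
    exact ⟨fun u hu => (h u (Or.inl hu)).trans (hz u hu),
      fun u hu => (h u (Or.inr hu)).trans (hz' u hu)⟩

theorem measurable_eval_generateFrom {p : V → Prop} {u : V} (hu : p u) :
    Measurable[MeasurableSpace.generateFrom (cylinders G p)] fun z : indepSets G => z.1 u := by
  refine @measurable_to_bool _ (MeasurableSpace.generateFrom (cylinders G p)) _ ?_
  refine MeasurableSpace.measurableSet_generateFrom ⟨fun _ => true, {u}, by simpa using hu, ?_⟩
  ext z
  simp [cylinder]

theorem outsideSigma_eq_generateFrom (G : SimpleGraph V) (U : Finset V) :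
    outsideSigma G U = MeasurableSpace.generateFrom (cylinders G fun u => u ∉ U) := by
  refine le_antisymm ?_ (MeasurableSpace.generateFrom_le ?_)
  · exact Measurable.comap_le
      (@measurable_pi_lambda _ _ _ (MeasurableSpace.generateFrom (cylinders G fun u => u ∉ U)) _ _
        fun u => measurable_eval_generateFrom u.2)
  · rintro _ ⟨x, F, hF, rfl⟩
    exact measurableSet_cylinder_outsideSigma x hF

theorem measurableSpace_eq_generateFrom (G : SimpleGraph V) :
    (inferInstance : MeasurableSpace (indepSets G)) =
      MeasurableSpace.generateFrom (cylinders G fun _ => True) := by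
  refine le_antisymm ?_ (MeasurableSpace.generateFrom_le ?_)
  · exact Measurable.comap_le
      (@measurable_pi_lambda _ _ _ (MeasurableSpace.generateFrom (cylinders G fun _ => True)) _ _
        fun u => measurable_eval_generateFrom trivial)
  · rintro _ ⟨x, F, -, rfl⟩
    exact measurableSet_cylinder G x F

theorem exists_comp_restrict_eq {f : indepSets G → ℝ} {K : Finset V}
    (hf : ∀ y z : indepSets G, (∀ u ∈ K, y.1 u = z.1 u) → f y = f z) :
    ∃ g : (K → Bool) → ℝ, g ∘ (fun (z : indepSets G) (u : K) => z.1 u) = f :=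
  ⟨_, Function.FactorsThrough.extend_comp (fun _ => (0 : ℝ))
    fun y z h => hf y z fun u hu => congrFun h ⟨u, hu⟩⟩

theorem continuous_of_local {f : indepSets G → ℝ} {K : Finset V}
    (hf : ∀ y z : indepSets G, (∀ u ∈ K, y.1 u = z.1 u) → f y = f z) : Continuous f := by
  obtain ⟨g, rfl⟩ := exists_comp_restrict_eq hf
  exact continuous_of_discreteTopology.comp
    (continuous_pi fun u => (continuous_apply u.1).comp continuous_subtype_val)

theorem measurable_outsideSigma_of_local {f : indepSets G → ℝ} {K U : Finset V}
    (hf : ∀ y z : indepSets G, (∀ u ∈ K, y.1 u = z.1 u) → f y = f z) (hK : ∀ u ∈ K, u ∉ U) :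
    Measurable[outsideSigma G U] f := by
  obtain ⟨g, rfl⟩ := exists_comp_restrict_eq hf
  exact (Measurable.of_discrete (f := g)).comp
    (@measurable_pi_lambda _ _ _ (outsideSigma G U) _ _
      fun u => measurable_eval_outsideSigma (hK u.1 u.2))

theorem isClosed_indepSets (G : SimpleGraph V) : IsClosed (indepSets G) := by
  have : indepSets G = ⋂ (u) (w) (_ : G.Adj u w), {x | ¬ (x u = true ∧ x w = true)} := by
    ext x
    simp [indepSets]
  rw [this]
  refine isClosed_iInter fun u => isClosed_iInter fun w => isClosed_iInter fun _ => ?_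
  have hc : Continuous fun x : V → Bool => (x u, x w) :=
    (continuous_apply u).prodMk (continuous_apply w)
  exact (isClosed_discrete {p : Bool × Bool | ¬ (p.1 = true ∧ p.2 = true)}).preimage hc

instance compactSpace_indepSets (G : SimpleGraph V) : CompactSpace (indepSets G) :=
  isCompact_iff_compactSpace.1 (isClosed_indepSets G).isCompact

theorem false_mem_indepSets (G : SimpleGraph V) : (fun _ => false) ∈ indepSets G :=
  fun _ _ _ _ => rfl

/-! ### Gibbs measures -/

variable {lam : V → ℝ} {P : Measure (indepSets G)}

theorem setOf_singleton_eq (u : V) : {z : V → Bool | ∀ w ∈ ({u} : Finset V), z w = false} =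
    {s | s u = false} := by
  ext
  simp

theorem IsGibbs.integrable_specification (h : IsGibbs G lam P) {U U' : Finset V} (hU : U' ⊆ U)
    {x : V → Bool} (hx : x ∈ indepSets G) :
    Integrable (fun y : indepSets G => specification G lam U y.1 {z | ∀ u ∈ U', z u = x u}) P :=
  integrable_condExp.congr (h.condExp_eq U U' hU x hx)

theorem IsGibbs.setIntegral_specification (h : IsGibbs G lam P) {U U' : Finset V} (hU : U' ⊆ U)
    {x : V → Bool} (hx : x ∈ indepSets G) {A : Set (indepSets G)}
    (hA : MeasurableSet[outsideSigma G U] A) :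
    ∫ y in A, specification G lam U y.1 {z | ∀ u ∈ U', z u = x u} ∂P =
      P.real (cylinder G x U' ∩ A) := by
  have := h.isProbabilityMeasure
  have hint : Integrable ((cylinder G x U').indicator fun _ => (1 : ℝ)) P :=
    (integrable_const 1).indicator (measurableSet_cylinder G x U')
  rw [← integral_congr_ae (ae_restrict_of_ae (h.condExp_eq U U' hU x hx)),
    setIntegral_condExp (outsideSigma_le G U) hint hA,
    integral_indicator_const _ (measurableSet_cylinder G x U'),
    measureReal_restrict_apply (measurableSet_cylinder G x U')]
  simp

/-- Integrates the Gibbs property over an event off `D`. When `u ∉ D` the specification is itself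
the indicator of `unoccupied G u`. -/
theorem IsGibbs.abs_real_sub_le (hlam : ∀ u, 0 < lam u) (h : IsGibbs G lam P) {D : Finset V}
    {u : V} {A : Set (indepSets G)} (hA : MeasurableSet[outsideSigma G D] A) {q ε : ℝ}
    (hq : ∀ y ∈ A, |specification G lam D y.1 {s | s u = false} - q| ≤ ε) :
    |P.real (unoccupied G u ∩ A) - q * P.real A| ≤ ε * P.real A := by
  classical
  have := h.isProbabilityMeasure
  have key : Integrable (fun y : indepSets G => specification G lam D y.1 {s | s u = false}) P ∧
      ∫ y in A, specification G lam D y.1 {s | s u = false} ∂P =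
        P.real (unoccupied G u ∩ A) := by
    by_cases hu : u ∈ D
    · have hu' : ({u} : Finset V) ⊆ D := by simpa using hu
      have h1 := h.setIntegral_specification hu' (false_mem_indepSets G) hA
      have h2 := h.integrable_specification hu' (false_mem_indepSets G)
      rw [setOf_singleton_eq] at h1 h2
      rw [unoccupied_eq_cylinder]
      exact ⟨h2, h1⟩
    · have h1 : (fun y : indepSets G => specification G lam D y.1 {s | s u = false}) =
          (unoccupied G u).indicator fun _ => (1 : ℝ) := by
        funext y
        rw [specification_of_notMem hlam hu y.2]
        simp [Set.indicator_apply, unoccupied]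
      rw [h1, integral_indicator_const _ (measurableSet_unoccupied G u),
        measureReal_restrict_apply (measurableSet_unoccupied G u)]
      exact ⟨(integrable_const 1).indicator (measurableSet_unoccupied G u), by simp⟩
  have h2 : ∫ y in A, (specification G lam D y.1 {s | s u = false} - q) ∂P =
      P.real (unoccupied G u ∩ A) - q * P.real A := by
    rw [integral_sub key.1.integrableOn (integrable_const q).integrableOn, key.2]
    simp [mul_comm]
  rw [← h2]
  exact norm_setIntegral_le_of_norm_le_const (measure_lt_top P A)
    fun y hy => (Real.norm_eq_abs _).trans_le (hq y hy)

/-- Occupy the occupied vertices of `x` in `F` and leave the rest of `U` empty. As `U` contains all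
neighbours of `F`, no boundary condition obstructs this. -/
theorem specification_cylinder_pos (hlam : ∀ u, 0 < lam u) {U F : Finset V} (hF : F ⊆ U)
    (hFU : ∀ u ∈ F, ∀ w, G.Adj u w → w ∈ U) {x y : V → Bool} (hx : x ∈ indepSets G)
    (hy : y ∈ indepSets G) : 0 < specification G lam U y {z | ∀ u ∈ F, z u = x u} := by
  classical
  refine div_pos (Finset.sum_pos (fun S _ => weight_pos hlam _ _)
    ⟨F.filter fun u => x u = true, ?_⟩) ?_
  · have hS : (F.filter fun u => x u = true) ⊆ U := (Finset.filter_subset _ _).trans hF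
    simp only [Finset.mem_filter, Finset.mem_powerset, Set.mem_inter_iff, Set.mem_ofPred_eq]
    refine ⟨hS, (patch_mem_indepSets_iff hS hy).2 ⟨?_, ?_⟩, ?_⟩
    · intro u hu w hw hadj
      simp only [Finset.mem_filter] at hu hw
      simpa [hw.2] using hx u w hadj hu.2
    · intro u hu w hw hadj
      exact (hw (hFU u (Finset.mem_filter.1 hu).1 w hadj)).elim
    · intro u hu
      rw [Bool.eq_iff_iff, patch_of_mem (hF hu)]
      simp [hu]
  · rw [volumeMass_eq_volumeSum, Set.indicator_univ]
    exact volumeSum_pos hlam U hy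

theorem IsGibbs.cylinder_pos (hG : ∀ u, (G.neighborSet u).Finite) (hlam : ∀ u, 0 < lam u)
    (h : IsGibbs G lam P) {x : V → Bool} (hx : x ∈ indepSets G) (F : Finset V) :
    0 < P (cylinder G x F) := by
  classical
  have := h.isProbabilityMeasure
  set U := F ∪ F.biUnion fun u => (hG u).toFinset with hU
  have hF : F ⊆ U := Finset.subset_union_left
  have hFU : ∀ u ∈ F, ∀ w, G.Adj u w → w ∈ U := fun u hu w hadj =>
    Finset.mem_union_right _ (Finset.mem_biUnion.2 ⟨u, hu, by simpa using hadj⟩)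
  have h1 := h.setIntegral_specification hF hx MeasurableSet.univ
  rw [setIntegral_univ, Set.inter_univ] at h1
  have hpos : ∀ y : indepSets G, 0 < specification G lam U y.1 {z | ∀ u ∈ F, z u = x u} :=
    fun y => specification_cylinder_pos hlam hF hFU hx y.2
  have h2 : 0 < P.real (cylinder G x F) := by
    rw [← h1, integral_pos_iff_support_of_nonneg (fun y => (hpos y).le)
      (h.integrable_specification hF hx)]
    have : (Function.support fun y : indepSets G =>
        specification G lam U y.1 {z | ∀ u ∈ F, z u = x u}) = Set.univ :=
      Set.eq_univ_of_forall fun y => (hpos y).ne'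
    rw [this]
    simp
  exact (ENNReal.toReal_pos_iff.1 h2).1

theorem IsGibbs.abs_cond_sub_le (hG : ∀ u, (G.neighborSet u).Finite) (hlam : ∀ u, 0 < lam u)
    (h : IsGibbs G lam P) {D F : Finset V} (hF : ∀ w ∈ F, w ∉ D) {u : V} {x : V → Bool}
    (hx : x ∈ indepSets G) {q ε : ℝ}
    (hq : ∀ y ∈ indepSets G, (∀ w ∈ F, y w = x w) →
      |specification G lam D y {s | s u = false} - q| ≤ ε) :
    |(ProbabilityTheory.cond P (cylinder G x F)).real (unoccupied G u) - q| ≤ ε := by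
  have := h.isProbabilityMeasure
  have hpos : 0 < P.real (cylinder G x F) :=
    ENNReal.toReal_pos (h.cylinder_pos hG hlam hx F).ne' (measure_ne_top _ _)
  have h1 := h.abs_real_sub_le hlam (measurableSet_cylinder_outsideSigma (G := G) x hF)
    fun y hy => hq y.1 y.2 hy
  have h2 : (ProbabilityTheory.cond P (cylinder G x F)).real (unoccupied G u) =
      P.real (unoccupied G u ∩ cylinder G x F) / P.real (cylinder G x F) := by
    rw [Measure.real, ProbabilityTheory.cond_apply (measurableSet_cylinder G x F),
      ENNReal.toReal_mul, ENNReal.toReal_inv, Set.inter_comm, div_eq_inv_mul]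
    rfl
  rw [h2, div_sub' hpos.ne', abs_div, abs_of_pos hpos, div_le_iff₀ hpos, mul_comm _ q]
  exact h1

/-- Decay of correlations implies that there is at most one Gibbs measure. -/
theorem HasDecay.eq_of_isGibbs (hlam : ∀ u, 0 < lam u) (hd : HasDecay G lam)
    {Q : Measure (indepSets G)} (hP : IsGibbs G lam P) (hQ : IsGibbs G lam Q) : P = Q := by
  classical
  have := hP.isProbabilityMeasure
  have := hQ.isProbabilityMeasure
  have key : ∀ x ∈ indepSets G, ∀ F : Finset V,
      P.real (cylinder G x F) = Q.real (cylinder G x F) := by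
    intro x hx F
    induction F using Finset.induction_on with
    | empty => simp [cylinder]
    | insert u F hu ih =>
      have hF : P.real (unoccupied G u ∩ cylinder G x F) =
          Q.real (unoccupied G u ∩ cylinder G x F) := by
        refine eq_of_forall_dist_le fun ε hε => ?_
        -- The volume is `B \ F`, so that `[x_F]` is an event outside it and fixes every boundary
        -- value in `B`. Both measures are then compared with the law under boundary condition `x`.
        obtain ⟨B, -, hB⟩ := hd u (ε / 2) (by positivity)
        have hFD : ∀ w ∈ F, w ∉ B \ F := by simp +contextual
        have hq : ∀ y ∈ cylinder G x F, |specification G lam (B \ F) y.1 {s | s u = false} -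
            specification G lam (B \ F) x {s | s u = false}| ≤ ε / 2 := fun y hy =>
          hB _ _ y.2 _ hx fun w hwB hwD => hy w (by simpa [hwB] using hwD)
        have h1 := hP.abs_real_sub_le hlam (measurableSet_cylinder_outsideSigma x hFD) hq
        have h2 := hQ.abs_real_sub_le hlam (measurableSet_cylinder_outsideSigma x hFD) hq
        rw [← ih] at h2
        have h3 : ε / 2 * P.real (cylinder G x F) ≤ ε / 2 * 1 :=
          mul_le_mul_of_nonneg_left measureReal_le_one (by positivity)
        rw [Real.dist_eq]
        rw [abs_le] at h1 h2 ⊢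
        constructor <;> linarith [h1.1, h1.2, h2.1, h2.2]
      have hcyl : cylinder G x (insert u F : Finset V) = if x u = false
          then unoccupied G u ∩ cylinder G x F else cylinder G x F \ unoccupied G u := by
        ext z
        split_ifs with hxu
        · simp [cylinder, unoccupied, hxu]
        · simp [cylinder, unoccupied, hxu, and_comm]
      rw [hcyl]
      split_ifs
      · exact hF
      · have hP' := measureReal_sdiff_add_inter (μ := P) (s := cylinder G x F)
          (measurableSet_unoccupied G u)
        have hQ' := measureReal_sdiff_add_inter (μ := Q) (s := cylinder G x F)
          (measurableSet_unoccupied G u)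
        rw [Set.inter_comm] at hP' hQ'
        linarith
  refine ext_of_generate_finite _ (measurableSpace_eq_generateFrom G) (isPiSystem_cylinders G _)
    ?_ (by simp)
  rintro _ ⟨x, F, -, rfl⟩
  -- `x` need not be independent here; a nonempty cylinder is also the cylinder of any of its
  -- members.
  rcases (cylinder G x F).eq_empty_or_nonempty with h0 | ⟨z, hz⟩
  · simp [h0]
  · have : cylinder G x F = cylinder G z.1 F := by
      ext s
      exact forall₂_congr fun u hu => by rw [hz u hu]
    rw [this]
    exact (measureReal_eq_measureReal_iff).1 (key z.1 z.2 F)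

end

/-! ### Existence of Gibbs measures -/

section

variable {G : SimpleGraph V} {lam : V → ℝ}

theorem exists_probabilityMeasure_integral_eq_volumeSum [Countable V] (hlam : ∀ u, 0 < lam u)
    (W : Finset V) {y : V → Bool} (hy : y ∈ indepSets G) :
    ∃ μ : ProbabilityMeasure (indepSets G), ∀ f : (V → Bool) → ℝ,
      ∫ z, f z.1 ∂(μ : Measure (indepSets G)) =
        volumeSum G lam W y f / volumeSum G lam W y 1 := by
  classical
  have hZ := volumeSum_pos (G := G) hlam W hy
  set Z := volumeSum G lam W y 1 with hZdef
  let s := W.powerset.filter fun S => patch W S y ∈ indepSets G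
  let pt : Finset V → indepSets G := fun S =>
    -- The default point is never charged, because `s` contains only admissible sets.
    if h : patch W S y ∈ indepSets G then ⟨_, h⟩ else ⟨y, hy⟩
  let c : Finset V → ℝ := fun S => weight lam W (patch W S y) / Z
  have hc : ∀ S, 0 ≤ c S := fun S => (div_pos (weight_pos hlam _ _) hZ).le
  let μ : Measure (indepSets G) := ∑ S ∈ s, ENNReal.ofReal (c S) • Measure.dirac (pt S)
  have hμ : IsProbabilityMeasure μ := by
    refine ⟨?_⟩
    have h1 : ∑ S ∈ s, c S = 1 := by
      rw [← Finset.sum_div, div_eq_one_iff_eq hZ.ne', hZdef]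
      simp [volumeSum, s]
    simp only [μ, Measure.coe_finsetSum, Finset.sum_apply, Measure.smul_apply, measure_univ,
      smul_eq_mul, mul_one]
    rw [← ENNReal.ofReal_sum_of_nonneg fun S _ => hc S, h1, ENNReal.ofReal_one]
  refine ⟨⟨μ, hμ⟩, fun f => ?_⟩
  change ∫ z, f z.1 ∂μ = _
  simp only [μ]
  rw [integral_finsetSum_measure fun S _ =>
    (integrable_dirac (by simp)).smul_measure ENNReal.ofReal_ne_top]
  rw [volumeSum, Finset.sum_div]
  refine Finset.sum_congr rfl fun S hS => ?_
  have hS' : patch W S y ∈ indepSets G := (Finset.mem_filter.1 hS).2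
  rw [integral_smul_measure, integral_dirac, ENNReal.toReal_ofReal (hc S)]
  simp only [pt, dif_pos hS', c, smul_eq_mul]
  ring

theorem specification_local (hG : ∀ u, (G.neighborSet u).Finite) (U : Finset V) :
    ∃ K : Finset V, (∀ u ∈ K, u ∉ U) ∧ ∀ U' ⊆ U, ∀ x : V → Bool, ∀ y z : indepSets G,
      (∀ u ∈ K, y.1 u = z.1 u) → specification G lam U y.1 {s | ∀ u ∈ U', s u = x u} =
        specification G lam U z.1 {s | ∀ u ∈ U', s u = x u} := by
  classical
  refine ⟨(U.biUnion fun u => (hG u).toFinset) \ U, fun u hu => (Finset.mem_sdiff.1 hu).2, ?_⟩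
  intro U' hU' x y z h
  refine specification_congr_of_adj y.2 z.2 (fun u hu w hw hadj => h w ?_) hU' x
  exact Finset.mem_sdiff.2 ⟨Finset.mem_biUnion.2 ⟨u, hu, by simpa using hadj⟩, hw⟩

/-- The Gibbs property of the law in `W`: resampling inside `U` does not change an event that
depends on coordinates off `U`. -/
theorem volumeSum_indicator_specification (hlam : ∀ u, 0 < lam u) {U W F : Finset V} (hUW : U ⊆ W)
    (hF : ∀ u ∈ F, u ∉ U) (y x₀ : V → Bool) (B : Set (V → Bool)) :
    volumeSum G lam W y ({z | ∀ u ∈ F, z u = x₀ u}.indicator (B.indicator 1)) =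
      volumeSum G lam W y
        ({z | ∀ u ∈ F, z u = x₀ u}.indicator fun z => specification G lam U z B) := by
  classical
  rw [← volumeSum_volumeSum hlam hUW]
  refine volumeSum_congr fun z _ _ => ?_
  have hA : ∀ s : V → Bool, (∀ u ∉ U, s u = z u) →
      (s ∈ {z : V → Bool | ∀ u ∈ F, z u = x₀ u} ↔ z ∈ {z : V → Bool | ∀ u ∈ F, z u = x₀ u}) :=
    fun s hs => forall₂_congr fun u hu => by rw [hs u (hF u hu)]
  by_cases hz : z ∈ {z : V → Bool | ∀ u ∈ F, z u = x₀ u}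
  · rw [Set.indicator_of_mem hz, specification_eq_volumeSum]
    congr 1
    exact volumeSum_congr fun s _ hs => Set.indicator_of_mem ((hA s hs).2 hz) _
  · rw [Set.indicator_of_notMem hz, volumeSum_congr (g := fun _ => 0) fun s _ hs =>
      Set.indicator_of_notMem (fun h => hz ((hA s hs).1 h)) _, volumeSum_const, mul_zero, zero_div]

/-- A weak limit of finite-volume laws with empty boundary condition is Gibbs. By local finiteness
the specification depends on finitely many coordinates, hence is continuous, so the identity on
cylinders passes to the limit; a π-λ argument extends it to `outsideSigma G U`. -/
theorem exists_isGibbs [Countable V] (hG : ∀ u, (G.neighborSet u).Finite)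
    (hlam : ∀ u, 0 < lam u) : ∃ P : Measure (indepSets G), IsGibbs G lam P := by
  classical
  choose μ hμ using fun W : Finset V =>
    exists_probabilityMeasure_integral_eq_volumeSum hlam W (false_mem_indepSets G)
  let 𝒰 : Ultrafilter (Finset V) := Ultrafilter.of atTop
  obtain ⟨P, -, hP⟩ := isCompact_univ.ultrafilter_le_nhds (𝒰.map μ) (by simp)
  have hlim : ∀ f : indepSets G → ℝ, Continuous f →
      Tendsto (fun W => ∫ z, f z ∂(μ W : Measure (indepSets G))) 𝒰
        (𝓝 (∫ z, f z ∂(P : Measure (indepSets G)))) := fun f hf =>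
    ProbabilityMeasure.tendsto_iff_forall_integral_tendsto.1 hP
      (BoundedContinuousFunction.mkOfCompact ⟨f, hf⟩)
  refine ⟨P, inferInstance, fun U U' hU x _ => ?_⟩
  obtain ⟨K, hKU, hK⟩ := specification_local (lam := lam) hG U
  set B : Set (V → Bool) := {z | ∀ u ∈ U', z u = x u} with hB
  let g : indepSets G → ℝ := fun y => specification G lam U y.1 B
  have hgK : ∀ y z : indepSets G, (∀ u ∈ K, y.1 u = z.1 u) → g y = g z := hK U' hU x
  have hgm := measurable_outsideSigma_of_local hgK hKU
  have hgint : Integrable g (P : Measure (indepSets G)) := by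
    refine Integrable.of_bound (hgm.mono (outsideSigma_le G U) le_rfl).aestronglyMeasurable 1
      (ae_of_all _ fun y => ?_)
    rw [Real.norm_eq_abs, abs_of_nonneg (specification_nonneg hlam U B)]
    exact specification_le_one hlam U y.2 B
  let f : indepSets G → ℝ := (cylinder G x U').indicator fun _ => 1
  have hfint : Integrable f (P : Measure (indepSets G)) :=
    (integrable_const 1).indicator (measurableSet_cylinder G x U')
  have hcyl : ∀ (x₀ : V → Bool) (F : Finset V), (∀ u ∈ F, u ∉ U) →
      ∫ y in cylinder G x₀ F, g y ∂(P : Measure (indepSets G)) =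
        ∫ y in cylinder G x₀ F, f y ∂(P : Measure (indepSets G)) := by
    intro x₀ F hF
    rw [← integral_indicator (measurableSet_cylinder G x₀ F),
      ← integral_indicator (measurableSet_cylinder G x₀ F)]
    have h1 : (cylinder G x₀ F).indicator g = fun z : indepSets G =>
        ({z : V → Bool | ∀ u ∈ F, z u = x₀ u}.indicator fun z => specification G lam U z B) z.1 := by
      funext z
      simp [Set.indicator_apply, cylinder, g]
    have h2 : (cylinder G x₀ F).indicator f = fun z : indepSets G =>
        ({z : V → Bool | ∀ u ∈ F, z u = x₀ u}.indicator (B.indicator 1)) z.1 := by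
      funext z
      simp [Set.indicator_apply, cylinder, f, hB]
    have hA : ∀ y z : indepSets G, (∀ u ∈ F, y.1 u = z.1 u) →
        (y ∈ cylinder G x₀ F ↔ z ∈ cylinder G x₀ F) :=
      fun y z h => forall₂_congr fun u hu => by rw [h u hu]
    have hc1 : Continuous ((cylinder G x₀ F).indicator g) := by
      refine continuous_of_local (K := F ∪ K) fun y z h => ?_
      rw [Set.indicator_apply, Set.indicator_apply,
        hgK y z fun u hu => h u (Finset.mem_union_right _ hu)]
      simp only [hA y z fun u hu => h u (Finset.mem_union_left _ hu)]
    have hc2 : Continuous ((cylinder G x₀ F).indicator f) := by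
      refine continuous_of_local (K := F ∪ U') fun y z h => ?_
      have hU : y ∈ cylinder G x U' ↔ z ∈ cylinder G x U' :=
        forall₂_congr fun u hu => by rw [h u (Finset.mem_union_right _ hu)]
      simp only [f, Set.indicator_apply, hU,
        hA y z fun u hu => h u (Finset.mem_union_left _ hu)]
    refine tendsto_nhds_unique (hlim _ hc1) ((hlim _ hc2).congr' ?_)
    -- The ultrafilter refines `atTop`, so the finite-volume identity is available eventually.
    have hev : ∀ᶠ W in (𝒰 : Filter (Finset V)), U ⊆ W :=
      Ultrafilter.of_le atTop (eventually_ge_atTop U)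
    filter_upwards [hev] with W hW
    rw [h1, h2, hμ W, hμ W, volumeSum_indicator_specification hlam hW hF]
  have hset : ∀ s, MeasurableSet[outsideSigma G U] s →
      ∫ y in s, g y ∂(P : Measure (indepSets G)) =
        ∫ y in s, f y ∂(P : Measure (indepSets G)) := by
    intro s hs
    induction s, hs using MeasurableSpace.induction_on_inter
      (outsideSigma_eq_generateFrom G U) (isPiSystem_cylinders G _) with
    | empty => simp
    | basic t ht =>
      obtain ⟨x₀, F, hF, rfl⟩ := ht
      exact hcyl x₀ F hF
    | compl t ht ih =>
      have ht' := outsideSigma_le G U t ht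
      have huniv := hcyl x ∅ (by simp)
      have : cylinder G x (∅ : Finset V) = Set.univ := by simp [cylinder]
      rw [this, setIntegral_univ, setIntegral_univ] at huniv
      have e1 := integral_add_compl ht' hgint
      have e2 := integral_add_compl ht' hfint
      linarith
    | iUnion t hd ht ih =>
      have ht' : ∀ i, MeasurableSet (t i) := fun i => outsideSigma_le G U _ (ht i)
      rw [integral_iUnion ht' hd hgint.integrableOn, integral_iUnion ht' hd hfint.integrableOn]
      exact tsum_congr ih
  exact (ae_eq_condExp_of_forall_setIntegral_eq (outsideSigma_le G U) hfint
    (fun s _ _ => hgint.integrableOn) (fun s hs _ => hset s hs)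
    hgm.stronglyMeasurable.aestronglyMeasurable).symm

end

/-! ### Boundary conditions on the tree of self-avoiding walks -/

section

variable {G : SimpleGraph V} {v : V}

theorem sawEnd_mem (w : SAWVertex G v) : sawEnd w ∈ w.1 :=
  List.getLast_mem _

/-- Only the vertices visited by `w` matter, which lets `U` be replaced by the complement of a
finite volume on finitely many trails. -/
theorem mem_sawCondSet_congr {U U' : Set V} {w : SAWVertex G v}
    (h : ∀ c ∈ w.1, c ∈ U ↔ c ∈ U') : w ∈ sawCondSet G v U ↔ w ∈ sawCondSet G v U' :=
  or_congr (h _ (sawEnd_mem w))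
    (and_congr_right fun _ => forall₂_congr fun c hc => not_congr (h c hc))

theorem sawCondValue_congr (idx : V → V → ℕ) {U U' : Set V} {x y : V → Bool} {w : SAWVertex G v}
    (h : ∀ c ∈ w.1, c ∈ U ↔ c ∈ U') (hxy : ∀ c ∈ w.1, c ∈ U → x c = y c) :
    sawCondValue G idx v x U w = sawCondValue G idx v y U' w := by
  classical
  simp only [sawCondValue, h _ (sawEnd_mem w)]
  split_ifs with hU
  · exact hxy _ (sawEnd_mem w) ((h _ (sawEnd_mem w)).2 hU)
  · rfl

open Classical in
/-- The configuration on the tree that equals `sawCondValue` on `sawCondSet` and is unoccupied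
elsewhere. -/
def sawBoundary (G : SimpleGraph V) (idx : V → V → ℕ) (v : V) (x : V → Bool) (U : Set V) :
    SAWVertex G v → Bool :=
  fun w => if w ∈ sawCondSet G v U then sawCondValue G idx v x U w else false

theorem sawBoundary_of_mem (idx : V → V → ℕ) (x : V → Bool) {U : Set V} {w : SAWVertex G v}
    (hw : w ∈ sawCondSet G v U) : sawBoundary G idx v x U w = sawCondValue G idx v x U w := by
  rw [sawBoundary, if_pos hw]

/-- Two adjacent occupied trails would both end in `U`, against the independence of `x`: a closing
trail has no extension, and one tagged off `U` cannot extend a trail ending in `U`. -/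
theorem sawBoundary_mem_indepSets (idx : V → V → ℕ) {x : V → Bool} (hx : x ∈ indepSets G)
    (U : Set V) : sawBoundary G idx v x U ∈ indepSets (sawTree G v) := by
  have key : ∀ w w' : SAWVertex G v, ∀ a, w'.1 = w.1 ++ [a] → sawBoundary G idx v x U w = true →
      sawBoundary G idx v x U w' = true → False := by
    intro w w' a hw h h'
    have hC : w ∈ sawCondSet G v U := by
      by_contra hC
      simp [sawBoundary, hC] at h
    have hC' : w' ∈ sawCondSet G v U := by
      by_contra hC'
      simp [sawBoundary, hC'] at h'
    rw [sawBoundary_of_mem idx x hC] at h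
    rw [sawBoundary_of_mem idx x hC'] at h'
    rcases hC with hU | ⟨hcl, -⟩
    · rcases hC' with hU' | ⟨-, hU'⟩
      · rw [sawCondValue_of_mem idx x (U := U) hU] at h
        rw [sawCondValue_of_mem idx x (U := U) hU'] at h'
        have hadj := adj_sawEnd_of_eq_append hw
        rw [← sawEnd_of_eq_append hw] at hadj
        simp [hx _ _ hadj h] at h'
      · exact hU' (sawEnd w) (by simp [hw, sawEnd_mem w]) hU
    · rcases w'.2 with h2 | h2
      · have := h2.2
        rw [hw] at this
        exact hcl.2.1 (List.nodup_append.1 this).1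
      · have := h2.2.2
        rw [hw] at this
        exact hcl.2.1 (by simpa using this)
  rintro w w' (⟨a, h⟩ | ⟨a, h⟩) hw
  · by_contra hw'
    exact key w w' a h hw (by simpa using hw')
  · by_contra hw'
    exact key w' w a h (by simpa using hw') hw

theorem finite_setOf_nodup_subset (W : Finset V) :
    {l : List V | l.Nodup ∧ ∀ c ∈ l, c ∈ W}.Finite := by
  classical
  refine (W.powerset.finite_toSet.biUnion fun S _ =>
    S.toList.permutations.finite_toSet).subset ?_
  rintro l ⟨hn, hl⟩
  refine Set.mem_biUnion (x := l.toFinset) ?_ ?_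
  · rw [Finset.mem_coe, Finset.mem_powerset]
    exact fun c hc => hl c (List.mem_toFinset.1 hc)
  · exact List.mem_permutations.2 (List.toFinset_toList hn).symm

theorem exists_finset_sawVertex (G : SimpleGraph V) (v : V) (W : Finset V) :
    ∃ E : Finset (SAWVertex G v), ∀ w, w ∈ E ↔ w.1.Nodup ∧ ∀ c ∈ w.1, c ∈ W := by
  have h := (finite_setOf_nodup_subset W).preimage
    (f := (Subtype.val : SAWVertex G v → List V)) Subtype.val_injective.injOn
  exact ⟨h.toFinset, fun w => by simp⟩

end

/-! ### Conditional probabilities -/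

/-- The number `q` may depend on `ε`: the bounds make `g` Cauchy, its limit stays close to each `q`,
and this forces `f` to the same limit. -/
theorem exists_tendsto_of_forall_exists_abs_sub_le {α β : Type*} {l : Filter α} {m : Filter β}
    [m.NeBot] {f : α → ℝ} {g : β → ℝ}
    (h : ∀ ε > 0, ∃ q, (∀ᶠ a in l, |f a - q| ≤ ε) ∧ ∀ᶠ b in m, |g b - q| ≤ ε) :
    ∃ p, Tendsto f l (𝓝 p) ∧ Tendsto g m (𝓝 p) := by
  have hc : Cauchy (map g m) := by
    rw [Metric.cauchy_iff]
    refine ⟨inferInstance, fun ε hε => ?_⟩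
    obtain ⟨q, -, hq⟩ := h (ε / 3) (by positivity)
    refine ⟨Metric.closedBall q (ε / 3), hq, fun a ha b hb => ?_⟩
    rw [Metric.mem_closedBall] at ha hb
    have := dist_triangle_right a b q
    linarith
  obtain ⟨p, hp⟩ := cauchy_map_iff_exists_tendsto.1 hc
  refine ⟨p, Metric.tendsto_nhds.2 fun ε hε => ?_, hp⟩
  obtain ⟨q, hf, hg⟩ := h (ε / 3) (by positivity)
  have hpq : |p - q| ≤ ε / 3 := le_of_tendsto ((hp.sub_const q).abs) hg
  filter_upwards [hf] with a ha
  have h1 : dist (f a) q ≤ ε / 3 := ha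
  have h2 : dist p q ≤ ε / 3 := hpq
  have := dist_triangle_right (f a) p q
  linarith

theorem eventually_finset_image {α : Type*} (K : Finset α) (C : Set α) :
    ∀ᶠ F : Finset C in atTop, ∃ F' : Finset α, (F' : Set α) = Subtype.val '' (F : Set C) ∧
      (∀ w ∈ F', w ∈ C) ∧ ∀ w ∈ K, w ∈ C → w ∈ F' := by
  classical
  filter_upwards [eventually_ge_atTop (K.subtype fun w => w ∈ C)] with F hF
  refine ⟨F.map (Function.Embedding.subtype _), by simp, ?_, ?_⟩
  · intro w hw
    obtain ⟨w', -, rfl⟩ := Finset.mem_map.1 hw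
    exact w'.2
  · intro w hw hC
    exact Finset.mem_map.2 ⟨⟨w, hC⟩, hF (by simpa using hw), rfl⟩

section

variable {G : SimpleGraph V} {lam : V → ℝ} {v : V}

theorem cylinder_congr {x y : V → Bool} {F : Set V} (h : ∀ u ∈ F, x u = y u) :
    cylinder G x F = cylinder G y F := by
  ext z
  exact forall₂_congr fun u hu => by rw [h u hu]

/-- The common approximant `q` is the root probability in the unconditioned part `D` of the decay
set `B`, with boundary condition `sawBoundary`. Mixing is used on the tree alone. -/
theorem exists_forall_eventually_abs_cond_sub_le (hG : ∀ u, (G.neighborSet u).Finite)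
    (hlam : ∀ u, 0 < lam u) {idx : V → V → ℕ}
    (hidx : ∀ u, Set.InjOn (idx u) (G.neighborSet u))
    (hd : HasDecay (sawTree G v) (sawActivity G lam v))
    {P : Measure (indepSets G)} {Q : Measure (indepSets (sawTree G v))} (hP : IsGibbs G lam P)
    (hQ : IsGibbs (sawTree G v) (sawActivity G lam v) Q) {x : V → Bool} (hx : x ∈ indepSets G)
    (U : Set V) {ε : ℝ} (hε : 0 < ε) :
    ∃ q : ℝ,
      (∀ᶠ F : Finset U in atTop, |(ProbabilityTheory.cond P (cylinder G x
        (Subtype.val '' (F : Set U)))).real (unoccupied G v) - q| ≤ ε) ∧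
      ∀ᶠ F : Finset (sawCondSet G v U) in atTop, |(ProbabilityTheory.cond Q
        (cylinder (sawTree G v) (sawCondValue G idx v x U)
          (Subtype.val '' (F : Set (sawCondSet G v U))))).real
            (unoccupied (sawTree G v) (sawRoot G v)) - q| ≤ ε := by
  classical
  have hlamT : ∀ w, 0 < sawActivity G lam v w := fun _ => hlam _
  obtain ⟨B, -, hB⟩ := hd (sawRoot G v) ε hε
  set C := sawCondSet G v U with hC
  set ξ := sawBoundary G idx v x U with hξ
  have hξX : ξ ∈ indepSets (sawTree G v) := sawBoundary_mem_indepSets idx hx U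
  set D := B.filter fun w => w ∉ C with hD
  have hDC : ∀ w ∈ B, w ∉ D → w ∈ C := fun w hw hwD => by
    by_contra h
    exact hwD (Finset.mem_filter.2 ⟨hw, h⟩)
  refine ⟨specification (sawTree G v) (sawActivity G lam v) D ξ {s | s (sawRoot G v) = false},
    ?_, ?_⟩
  · set K := B.biUnion fun w => w.1.toFinset with hK
    have hBK : ∀ w ∈ B, ∀ c ∈ w.1, c ∈ K := fun w hw c hc =>
      Finset.mem_biUnion.2 ⟨w, hw, List.mem_toFinset.2 hc⟩
    filter_upwards [eventually_finset_image K U] with F hF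
    obtain ⟨F, hF, hFU, hKF⟩ := hF
    rw [← hF]
    -- `F` contains `K ∩ U` and lies in `U`, so on the vertices visited by `B` the complement of `W`
    -- coincides with `U`.
    set W := K \ F with hW
    refine hP.abs_cond_sub_le hG hlam (D := W)
      (fun w hw h => (Finset.mem_sdiff.1 h).2 hw) hx fun y hy hyx => ?_
    have hWU : ∀ w ∈ B, ∀ c ∈ w.1, c ∈ U ↔ c ∈ {c | c ∉ W} := by
      intro w hw c hc
      have hcK := hBK w hw c hc
      rw [Set.mem_ofPred_eq, hW, Finset.mem_sdiff]
      exact ⟨fun h h' => h'.2 (hKF c hcK h), fun h => hFU c (by tauto)⟩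
    obtain ⟨E₀, hE₀⟩ := exists_finset_sawVertex G v W
    -- `E₀` is what the finite-volume identity requires; adjoining `D` lets the law in `E` be an
    -- average of laws in `D`.
    set E := E₀ ∪ D with hE
    set η := sawBoundary G idx v y {c | c ∉ W} with hη
    have hηX : η ∈ indepSets (sawTree G v) := sawBoundary_mem_indepSets idx hy _
    have hEC : ∀ w ∈ E, w ∉ sawCondSet G v {c | c ∉ W} := by
      intro w hw
      rcases Finset.mem_union.1 hw with hw | hw
      · obtain ⟨hn, hw⟩ := (hE₀ w).1 hw
        rintro (h | ⟨h, -⟩)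
        exacts [h (hw _ (sawEnd_mem w)), h.2.1 hn]
      · obtain ⟨hwB, hwC⟩ := Finset.mem_filter.1 hw
        rwa [← mem_sawCondSet_congr (hWU w hwB)]
    rw [specification_eq_specification_sawTree hlam hidx hy hηX
      (fun w hn hw => Finset.mem_union_left _ ((hE₀ w).2 ⟨hn, hw⟩)) hEC
      fun w hw => sawBoundary_of_mem idx y hw]
    refine abs_specification_sub_le hlamT Finset.subset_union_right hηX fun z hz hzη => ?_
    -- Points of `B` off `D` are conditioned for `U`, hence for the complement of `W`. They are
    -- therefore off `E`, where `z` equals `η`, and `η` agrees there with `ξ` because `y` agrees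
    -- with `x` on `F`.
    refine hB D z hz ξ hξX fun w hwB hwD => ?_
    have hwC := hDC w hwB hwD
    have hwC' := (mem_sawCondSet_congr (hWU w hwB)).1 hwC
    rw [hzη w fun h => hEC w h hwC', hη, hξ, sawBoundary_of_mem idx y hwC',
      sawBoundary_of_mem idx x hwC]
    exact (sawCondValue_congr idx (hWU w hwB) fun c hc hcU =>
      (hyx c (hKF c (hBK w hwB c hc) hcU)).symm).symm
  · filter_upwards [eventually_finset_image B C] with F hF
    obtain ⟨F, hF, hFC, hBF⟩ := hF
    rw [← hF, cylinder_congr (y := ξ) fun w hw => (sawBoundary_of_mem idx x (hFC w hw)).symm]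
    exact hQ.abs_cond_sub_le (sawTree_neighborSet_finite hG) hlamT (D := D)
      (fun w hw h => (Finset.mem_filter.1 h).2 (hFC w hw)) hξX
      fun y hy hyξ => hB D y hy ξ hξX fun w hwB hwD => hyξ w (hBF w hwB (hDC w hwB hwD))

end

end Hardcore

end

/-! ### The main theorem -/

theorem mainTheorem5 {V : Type*} [Countable V] (G : SimpleGraph V)
    (hG : ∀ u, (G.neighborSet u).Finite)
    (lam : V → ℝ) (hlam : ∀ u, 0 < lam u)
    (idx : V → V → ℕ) (hidx : ∀ u, Set.InjOn (idx u) (G.neighborSet u))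
    (v : V)
    (hSSM : Hardcore.StrongSpatialMixing (Hardcore.sawTree G v) (Hardcore.sawActivity G lam v)) :
    (∃ P, Hardcore.IsGibbs G lam P) ∧
    (∃! Q, Hardcore.IsGibbs (Hardcore.sawTree G v) (Hardcore.sawActivity G lam v) Q) ∧
    ∀ P Q, Hardcore.IsGibbs G lam P →
      Hardcore.IsGibbs (Hardcore.sawTree G v) (Hardcore.sawActivity G lam v) Q →
      ∀ x ∈ Hardcore.indepSets G, ∀ U : Set V, ∃ p : ℝ,
        Hardcore.HasCondProb G P (Hardcore.unoccupied G v) x U p ∧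
        Hardcore.HasCondProb (Hardcore.sawTree G v) Q
          (Hardcore.unoccupied (Hardcore.sawTree G v) (Hardcore.sawRoot G v))
          (Hardcore.sawCondValue G idx v x U) (Hardcore.sawCondSet G v U) p := by
  have hlamT : ∀ w, 0 < Hardcore.sawActivity G lam v w := fun _ => hlam _
  have hGT := Hardcore.sawTree_neighborSet_finite (v := v) hG
  have hd := Hardcore.hasDecay_sawTree hG hlam hSSM
  obtain ⟨Q₀, hQ₀⟩ := Hardcore.exists_isGibbs hGT hlamT
  refine ⟨Hardcore.exists_isGibbs hG hlam,
    ⟨Q₀, hQ₀, fun Q hQ => hd.eq_of_isGibbs hlamT hQ hQ₀⟩, ?_⟩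
  intro P Q hP hQ x hx U
  obtain ⟨p, hp, hp'⟩ := Hardcore.exists_tendsto_of_forall_exists_abs_sub_le fun ε hε =>
    Hardcore.exists_forall_eventually_abs_cond_sub_le hG hlam hidx hd hP hQ hx U hε
  refine ⟨p, ⟨fun F _ => hP.cylinder_pos hG hlam hx F, hp⟩, fun F hF => ?_, hp'⟩
  -- Positivity of cylinders is available for independent configurations, so the imposed values are
  -- replaced by their independent extension `sawBoundary`.
  rw [Hardcore.cylinder_congr fun w hw => (Hardcore.sawBoundary_of_mem idx x (hF hw)).symm]
  exact hQ.cylinder_pos hGT hlamT (Hardcore.sawBoundary_mem_indepSets idx hx U) F
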